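/- Let $\Gamma$ be a countable group with a proper left-invariant distance $\mathrm{dist}$ (proper: all balls are finite), and write $|g|=\mathrm{dist}(g,e)$. Let $\mu$ be a symmetric probability measure on $\Gamma$ (that is, $\mu(g^{-1})=\mu(g)$ for all $g$) with finite second moment, $M_2(\mu)=\bigl(\sum_g |g|^2\mu(g)\bigr)^{1/2}<\infty$. Let $\mu^{*n}$ be the $n$-fold convolution power of $\mu$, and put $$h=\lim_n -\frac1n\sum_g \mu^{*n}(g)\log\mu^{*n}(g)\in[0,\infty],\qquad \rho=\limsup_n \bigl(\mu^{*n}(e)\bigr)^{1/n},\qquad \ell=\lim_n\frac1n\sum_g |g|\,\mu^{*n}(g).$$ The sums and the limit defining $\ell$ exist and are finite, the limit $h$ exists in $[0,\infty]$ (it is $+\infty$ if the entropy of $\mu$ is infinite), $0<\rho\le 1$, and, with $A(x)=(1+x)\log(1+x)+(1-x)\log(1-x)$ (where $0\log 0=0$), $$A\bigl(\ell/M_2(\mu)\bigr)+2|\log\rho|\le h .$$ If $\mu=\delta_e$, so that $\ell=M_2(\mu)=0$, the quotient $\ell/M_2(\mu)$ is read as $0$. This lower bound for $h$ improves the bound $-2\log\rho\le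 h$ of Avez and, by a factor of $2$, the bound $A(\ell/k)/2-\log\rho\le h$ of Carne and Lœuillot: one has $$-2\log\rho\le A\bigl(\ell/M_2(\mu)\bigr)+2|\log\rho|,$$ and, whenever the support of $\mu$ is contained in the ball $\{g:|g|\le k\}$, $$2\bigl(A(\ell/k)/2-\log\rho\bigr)\le A\bigl(\ell/M_2(\mu)\bigr)+2|\log\rho|$$ (with $\ell/k$ read as $0$ if $k=0$). -/

import Mathlib

open Filter Topology
open scoped ENNReal

namespace RandomWalk

noncomputable section

/-- The law `μ^{*n}` of `X_n = γ₁ ⋯ γ_n`, where the `γ_i` are independent with law `μ`: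
`X_0 = e`, and `X_{n+1} = X_n γ_{n+1}`. -/
def convPow {Γ : Type*} [Group Γ] (μ : PMF Γ) : ℕ → PMF Γ
  | 0 => PMF.pure 1
  | n + 1 => (convPow μ n).bind fun x => μ.map fun g => x * g

/-- The distance `|g| = dist(g, e)` to the identity. -/
def length {Γ : Type*} [Group Γ] [MetricSpace Γ] (g : Γ) : ℝ := dist g 1

/-- The Shannon entropy `H(p) = -∑ p(g) log p(g) ∈ [0, ∞]`; all the terms are nonnegative. -/
def entropy {Γ : Type*} (p : PMF Γ) : ℝ≥0∞ :=
  ∑' g, ENNReal.ofReal (-((p g).toReal * Real.log (p g).toReal))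

/-- The asymptotic entropy `h = lim H(μ^{*n}) / n ∈ [0, ∞]`. -/
def asymptoticEntropy {Γ : Type*} [Group Γ] (μ : PMF Γ) : ℝ≥0∞ :=
  limUnder atTop fun n : ℕ => entropy (convPow μ n) / (n : ℝ≥0∞)

/-- The spectral radius `ρ = limsup (μ^{*n}(e))^{1/n}`. -/
def spectralRadius {Γ : Type*} [Group Γ] (μ : PMF Γ) : ℝ :=
  limsup (fun n : ℕ => (convPow μ n 1).toReal ^ (1 / (n : ℝ))) atTop

/-- The mean length `∑ |g| μ^{*n}(g)` at time `n`. -/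
def meanLength {Γ : Type*} [Group Γ] [MetricSpace Γ] (μ : PMF Γ) (n : ℕ) : ℝ :=
  ∑' g, length g * (convPow μ n g).toReal

/-- The drift `ℓ = lim (1/n) ∑ |g| μ^{*n}(g)`. -/
def drift {Γ : Type*} [Group Γ] [MetricSpace Γ] (μ : PMF Γ) : ℝ :=
  limUnder atTop fun n : ℕ => meanLength μ n / (n : ℝ)

/-- `M₂(μ) = (∑ |g|² μ(g))^{1/2}`. -/
def M₂ {Γ : Type*} [Group Γ] [MetricSpace Γ] (μ : PMF Γ) : ℝ :=
  Real.sqrt (∑' g, length g ^ 2 * (μ g).toReal)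

/-- `A(x) = (1+x) log(1+x) + (1-x) log(1-x)`; as `0 · log 0 = 0`, one has `A(1) = 2 log 2`. -/
def A (x : ℝ) : ℝ := (1 + x) * Real.log (1 + x) + (1 - x) * Real.log (1 - x)

end

end RandomWalk

namespace RandomWalk

/-! ### Convolution powers and independent increments. -/

section Convolution

variable {Γ : Type*} [Group Γ]

/-! Let `q` be the law of the walk stopped at an independent geometric time, `q = (1-s) δ_e + s
μ*q`. Choose an edge `x → gx` with weight `u = μ(g) q(x)`; since `μ` is symmetric, the reversed edge
has weight `v = μ(g) q(gx)`. Four averages over edges matter. The relative entropy `∑ u log(u/v)` is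
at most `H(q)(1-s)/s`, by the equation for `q`, and `H(q)` is controlled by the entropies of the
`μ^{*n}`; as `s → 1` the bound tends to any chosen `b > h` (`tendsto_entropy_bound`). The
displacement `|gx| - |x|`, which is odd under reversal, has `u`-mean at least `ℓ`, and its second
moment is at most `M₂²`. Finally `∑ √(uv) = ∑ μ(g) √(q(x) q(gx))` is the quadratic form of the
Markov operator at the unit vector `√q` of `ℓ²`, hence at most `ρ`.

These are combined edge by edge (`rate_pointwise`). With `T = (u-v)/(u+v)`, one has `(u-v) log(u/v)
= (u+v)(A(T) - log(1-T²))` and `√(uv) = (u+v) √(1-T²) / 2`. The term `A(T)` is convex increasing in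
`T²` and yields the drift, through the correlation of `T` with the displacement; the term
`-log(1-T²)` is convex in `√(1-T²)` and yields `-2 log ρ`. Replacing both by tangents makes
everything linear in the averages, and summation (`rate_le_relative_entropy`) gives `A(ℓ/M₂) - 2 log
ρ ≤ h`. -/

lemma tsum_inv_mul (x : Γ) (f : Γ → ℝ≥0∞) : ∑' y, f (x⁻¹ * y) = ∑' y, f y :=
  (Equiv.mulLeft x⁻¹).tsum_eq f

lemma convPow_succ_apply (μ : PMF Γ) (n : ℕ) (y : Γ) :
    convPow μ (n + 1) y = ∑' x, convPow μ n x * μ (x⁻¹ * y) := by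
  classical
  simp only [convPow, PMF.bind_apply]
  refine tsum_congr fun x => ?_
  rw [PMF.map_apply, tsum_eq_single (x⁻¹ * y)]
  · simp
  · intro g hg
    rw [if_neg]
    rintro rfl
    simp at hg

lemma convPow_zero_apply (μ : PMF Γ) (y : Γ) [Decidable (y = 1)] :
    convPow μ 0 y = if y = 1 then 1 else 0 := by
  simp [convPow, PMF.pure_apply]

lemma convPow_add_apply (μ : PMF Γ) (m n : ℕ) (y : Γ) :
    convPow μ (m + n) y = ∑' x, convPow μ m x * convPow μ n (x⁻¹ * y) := by
  classical
  induction n generalizing y with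
  | zero =>
    rw [tsum_eq_single y]
    · simp [convPow_zero_apply]
    · intro x hx
      rw [convPow_zero_apply, if_neg, mul_zero]
      rw [inv_mul_eq_one]
      exact hx
  | succ n ih =>
    rw [← add_assoc, convPow_succ_apply]
    simp_rw [ih, convPow_succ_apply, ← ENNReal.tsum_mul_left, ← ENNReal.tsum_mul_right]
    rw [ENNReal.tsum_comm]
    refine tsum_congr fun x => ?_
    symm
    rw [← tsum_inv_mul x]
    refine tsum_congr fun z => ?_
    rw [mul_assoc]
    congr 3
    group

lemma convPow_one (μ : PMF Γ) : convPow μ 1 = μ := by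
  classical
  ext y
  rw [convPow_succ_apply, tsum_eq_single 1]
  · simp [convPow_zero_apply]
  · intro x hx
    simp [convPow_zero_apply, hx]

/-- Expectation of a nonnegative function of a product of independent increments. -/
lemma tsum_conv_mul (a b F : Γ → ℝ≥0∞) :
    ∑' y, (∑' x, a x * b (x⁻¹ * y)) * F y = ∑' x, ∑' z, a x * b z * F (x * z) := by
  simp_rw [← ENNReal.tsum_mul_right]
  rw [ENNReal.tsum_comm]
  refine tsum_congr fun x => ?_
  symm
  rw [← tsum_inv_mul x]
  simp

lemma tsum_convPow_add_mul (μ : PMF Γ) (m n : ℕ) (F : Γ → ℝ≥0∞) :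
    ∑' y, convPow μ (m + n) y * F y
      = ∑' x, ∑' z, convPow μ m x * convPow μ n z * F (x * z) := by
  simp_rw [convPow_add_apply]
  exact tsum_conv_mul _ _ _

/-- Reversing the order of the increments and inverting each of them preserves the law. The
induction therefore splits off the last increment on one side and the first on the other. -/
lemma convPow_inv {μ : PMF Γ} (hsymm : ∀ g, μ g⁻¹ = μ g) (n : ℕ) (g : Γ) :
    convPow μ n g⁻¹ = convPow μ n g := by
  classical
  induction n generalizing g with
  | zero => simp [convPow_zero_apply]
  | succ n ih =>
    rw [convPow_succ_apply, add_comm n 1, convPow_add_apply, convPow_one, ← tsum_inv_mul g]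
    refine tsum_congr fun x => ?_
    rw [mul_comm, ← ih (g⁻¹ * x), ← hsymm x]
    congr 2 <;> group

lemma le_convPow_add (μ : PMF Γ) (m n : ℕ) (x z : Γ) :
    convPow μ m x * convPow μ n z ≤ convPow μ (m + n) (x * z) := by
  rw [convPow_add_apply]
  refine le_trans (le_of_eq ?_) (ENNReal.le_tsum x)
  simp

end Convolution

/-! ### Entropy of convolution powers and existence of its growth rate. -/

section Entropy

/-- The information content `-log t` of an event of probability `t ∈ (0, 1]`. -/
noncomputable def surprisal (t : ℝ≥0∞) : ℝ≥0∞ := ENNReal.ofReal (-Real.log t.toReal)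

/-- The factor `a * b` is kept on both sides because `surprisal 0 = 0` (as `Real.log 0 = 0`), so
that the inequality without it can fail when `a` or `b` vanishes. -/
lemma mul_surprisal_le {a b c : ℝ≥0∞} (ha : a ≤ 1) (hb : b ≤ 1) (hc : c ≤ 1) (h : a * b ≤ c) :
    a * b * surprisal c ≤ a * b * (surprisal a + surprisal b) := by
  rcases eq_or_ne a 0 with rfl | ha0
  · simp
  rcases eq_or_ne b 0 with rfl | hb0
  · simp
  have hat : a ≠ ⊤ := ne_top_of_le_ne_top ENNReal.one_ne_top ha
  have hbt : b ≠ ⊤ := ne_top_of_le_ne_top ENNReal.one_ne_top hb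
  have hct : c ≠ ⊤ := ne_top_of_le_ne_top ENNReal.one_ne_top hc
  gcongr
  have ha' := ENNReal.toReal_pos ha0 hat
  have hb' := ENNReal.toReal_pos hb0 hbt
  refine le_trans ?_ ENNReal.ofReal_add_le
  refine ENNReal.ofReal_le_ofReal ?_
  have h2 := ENNReal.toReal_mono hct h
  rw [ENNReal.toReal_mul] at h2
  have := Real.log_le_log (mul_pos ha' hb') h2
  rw [Real.log_mul ha'.ne' hb'.ne'] at this
  linarith

lemma toReal_mul_surprisal {a b : ℝ≥0∞} (hb : b ≤ 1) :
    (a * surprisal b).toReal = a.toReal * -Real.log b.toReal := by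
  have : Real.log b.toReal ≤ 0 :=
    Real.log_nonpos ENNReal.toReal_nonneg (ENNReal.toReal_mono ENNReal.one_ne_top hb)
  rw [ENNReal.toReal_mul, surprisal, ENNReal.toReal_ofReal (by linarith)]

lemma entropy_eq_tsum_mul_surprisal {Γ : Type*} (p : PMF Γ) :
    entropy p = ∑' g, p g * surprisal (p g) := by
  refine tsum_congr fun g => ?_
  rw [← mul_neg, ENNReal.ofReal_mul ENNReal.toReal_nonneg, ENNReal.ofReal_toReal (p.apply_ne_top g),
    surprisal]

/-- Gibbs' inequality. -/
lemma tsum_mul_surprisal_le_of_tsum_eq_one {ι : Type*} {p q : ι → ℝ≥0∞} (hp : ∑' i, p i = 1)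
    (hq : ∑' i, q i = 1) (hpq : ∀ i, p i ≠ 0 → q i ≠ 0) :
    ∑' i, p i * surprisal (p i) ≤ ∑' i, p i * surprisal (q i) := by
  have hp1 : ∀ i, p i ≤ 1 := fun i => hp ▸ ENNReal.le_tsum i
  have hq1 : ∀ i, q i ≤ 1 := fun i => hq ▸ ENNReal.le_tsum i
  -- This is `log t ≤ t - 1` at `t = q i / p i`, with the masses moved to avoid subtraction in
  -- `ℝ≥0∞`; they sum to `1` on each side and cancel.
  have key : ∀ i, p i * surprisal (p i) + p i ≤ p i * surprisal (q i) + q i := by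
    intro i
    rcases eq_or_ne (p i) 0 with h0 | h0
    · simp [h0]
    have hpt : p i ≠ ⊤ := ne_top_of_le_ne_top ENNReal.one_ne_top (hp1 i)
    have hqt : q i ≠ ⊤ := ne_top_of_le_ne_top ENNReal.one_ne_top (hq1 i)
    have hs : ∀ t, surprisal t ≠ ⊤ := fun t => ENNReal.ofReal_ne_top
    rw [← ENNReal.toReal_le_toReal (by finiteness [hs (p i)]) (by finiteness [hs (q i)]),
      ENNReal.toReal_add (by finiteness [hs (p i)]) hpt,
      ENNReal.toReal_add (by finiteness [hs (q i)]) hqt,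
      toReal_mul_surprisal (hp1 i), toReal_mul_surprisal (hq1 i)]
    have hp' := ENNReal.toReal_pos h0 hpt
    have hq' := ENNReal.toReal_pos (hpq i h0) hqt
    have h1 := Real.log_le_sub_one_of_pos (div_pos hq' hp')
    rw [Real.log_div hq'.ne' hp'.ne'] at h1
    have h2 := mul_le_mul_of_nonneg_left h1 hp'.le
    have h3 : (p i).toReal * ((q i).toReal / (p i).toReal - 1) = (q i).toReal - (p i).toReal := by
      field_simp
    linarith
  have := ENNReal.tsum_le_tsum key
  rw [ENNReal.tsum_add, ENNReal.tsum_add, hp, hq] at this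
  exact (ENNReal.add_le_add_iff_right ENNReal.one_ne_top).1 this

variable {Γ : Type*} [Group Γ]

lemma entropy_convPow_add_le (μ : PMF Γ) (m n : ℕ) :
    entropy (convPow μ (m + n)) ≤ entropy (convPow μ m) + entropy (convPow μ n) := by
  simp_rw [entropy_eq_tsum_mul_surprisal]
  rw [tsum_convPow_add_mul]
  calc _ ≤ ∑' x, ∑' z, convPow μ m x * convPow μ n z *
          (surprisal (convPow μ m x) + surprisal (convPow μ n z)) :=
        ENNReal.tsum_le_tsum fun x => ENNReal.tsum_le_tsum fun z =>
          mul_surprisal_le (PMF.coe_le_one _ _) (PMF.coe_le_one _ _) (PMF.coe_le_one _ _)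
            (le_convPow_add μ m n x z)
    _ = ∑' x, (convPow μ m x * surprisal (convPow μ m x) * ∑' z, convPow μ n z +
          convPow μ m x * ∑' z, convPow μ n z * surprisal (convPow μ n z)) := by
        refine tsum_congr fun x => ?_
        rw [← ENNReal.tsum_mul_left, ← ENNReal.tsum_mul_left, ← ENNReal.tsum_add]
        refine tsum_congr fun z => ?_
        ring
    _ = _ := by
        rw [ENNReal.tsum_add, ENNReal.tsum_mul_right, ENNReal.tsum_mul_right, PMF.tsum_coe,
          PMF.tsum_coe, mul_one, one_mul]

/-- Conditioning lowers entropy: given `X_n = x`, the law of `X_{n+1}` is a translate of `μ`, and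
Gibbs' inequality compares it with `μ^{*(n+1)}`. It makes infinite entropy of `μ` persist at all
positive times. -/
lemma entropy_le_entropy_convPow_succ (μ : PMF Γ) (n : ℕ) :
    entropy μ ≤ entropy (convPow μ (n + 1)) := by
  simp_rw [entropy_eq_tsum_mul_surprisal]
  rw [tsum_convPow_add_mul, convPow_one]
  calc _ = ∑' x, convPow μ n x * ∑' z, μ z * surprisal (μ z) := by
        rw [ENNReal.tsum_mul_right, PMF.tsum_coe, one_mul]
    _ ≤ _ := by
        refine ENNReal.tsum_le_tsum fun x => ?_
        simp_rw [mul_assoc]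
        rw [ENNReal.tsum_mul_left]
        rcases eq_or_ne (convPow μ n x) 0 with h0 | h0
        · simp [h0]
        refine mul_le_mul' le_rfl ?_
        refine tsum_mul_surprisal_le_of_tsum_eq_one μ.tsum_coe
          (q := fun z => convPow μ (n + 1) (x * z)) ?_ ?_
        · rw [← (convPow μ (n + 1)).tsum_coe]
          exact (Equiv.mulLeft x).tsum_eq _
        · intro z hz h
          have := le_convPow_add μ n 1 x z
          rw [h, convPow_one] at this
          exact mul_ne_zero h0 hz (le_antisymm this zero_le)

/-- Fekete's lemma for sequences that grow at most linearly. -/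
lemma tendsto_div_of_subadditive {a : ℕ → ℝ} (h0 : ∀ n, 0 ≤ a n)
    (h : ∀ m n, a (m + n) ≤ a m + a n) :
    ∃ l, Tendsto (fun n => a n / n) atTop (𝓝 l) ∧ ∀ n : ℕ, n * l ≤ a n := by
  have hs : Subadditive a := h
  have hb : BddBelow (Set.range fun n => a n / n) :=
    ⟨0, by rintro _ ⟨n, rfl⟩; exact div_nonneg (h0 n) n.cast_nonneg⟩
  refine ⟨hs.lim, hs.tendsto_lim hb, fun n => ?_⟩
  rcases Nat.eq_zero_or_pos n with rfl | hn
  · simpa using h0 0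
  have := hs.lim_le_div hb hn.ne'
  rw [le_div_iff₀ (by exact_mod_cast hn)] at this
  linarith

lemma entropy_convPow_ne_top {μ : PMF Γ} (hfin : entropy μ ≠ ⊤) (n : ℕ) :
    entropy (convPow μ n) ≠ ⊤ := by
  induction n with
  | zero =>
    classical
    rw [entropy_eq_tsum_mul_surprisal]
    have : ∀ g, convPow μ 0 g * surprisal (convPow μ 0 g) = 0 := by
      intro g
      rw [convPow_zero_apply]
      split_ifs <;> simp [surprisal]
    simp [this]
  | succ n ih =>
    refine ne_top_of_le_ne_top ?_ (entropy_convPow_add_le μ n 1)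
    rw [convPow_one]
    exact ENNReal.add_ne_top.2 ⟨ih, hfin⟩

lemma tendsto_asymptoticEntropy (μ : PMF Γ) :
    Tendsto (fun n : ℕ => entropy (convPow μ n) / (n : ℝ≥0∞)) atTop
      (𝓝 (asymptoticEntropy μ)) := by
  refine tendsto_nhds_limUnder ?_
  rcases eq_or_ne (entropy μ) ⊤ with htop | hfin
  · refine ⟨⊤, tendsto_const_nhds.congr' ?_⟩
    filter_upwards [eventually_gt_atTop 0] with n hn
    obtain ⟨k, rfl⟩ := Nat.exists_eq_succ_of_ne_zero hn.ne'
    have hk := entropy_le_entropy_convPow_succ μ k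
    rw [htop, top_le_iff] at hk
    rw [Nat.succ_eq_add_one, hk, ENNReal.top_div_of_ne_top]
    exact ENNReal.natCast_ne_top _
  · have hn := entropy_convPow_ne_top hfin
    obtain ⟨l, hl, -⟩ := tendsto_div_of_subadditive
      (a := fun n => (entropy (convPow μ n)).toReal) (fun n => ENNReal.toReal_nonneg) (by
        intro m n
        rw [← ENNReal.toReal_add (hn m) (hn n)]
        exact ENNReal.toReal_mono (ENNReal.add_ne_top.2 ⟨hn m, hn n⟩)
          (entropy_convPow_add_le μ m n))
    refine ⟨ENNReal.ofReal l, (ENNReal.tendsto_ofReal hl).congr' ?_⟩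
    filter_upwards [eventually_gt_atTop 0] with n hn0
    rw [ENNReal.ofReal_div_of_pos (by exact_mod_cast hn0), ENNReal.ofReal_toReal (hn n),
      ENNReal.ofReal_natCast]

end Entropy

/-! ### Return probabilities and the quadratic form of the Markov operator. -/

section SpectralRadius

variable {Γ : Type*} [Group Γ]

lemma toReal_convPow_le_one (μ : PMF Γ) (n : ℕ) (g : Γ) : (convPow μ n g).toReal ≤ 1 :=
  ENNReal.toReal_mono ENNReal.one_ne_top (PMF.coe_le_one _ _)

lemma toReal_convPow_one_rpow_le_one (μ : PMF Γ) (n : ℕ) :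
    (convPow μ n 1).toReal ^ (1 / (n : ℝ)) ≤ 1 :=
  Real.rpow_le_one ENNReal.toReal_nonneg (toReal_convPow_le_one μ n 1) (by positivity)

lemma spectralRadius_le_one (μ : PMF Γ) : spectralRadius μ ≤ 1 := by
  refine limsup_le_of_le ?_ (Eventually.of_forall fun n => toReal_convPow_one_rpow_le_one μ n)
  exact IsCoboundedUnder.of_frequently_ge (a := 0)
    (Frequently.of_forall fun n => Real.rpow_nonneg ENNReal.toReal_nonneg _)

lemma convPow_one_pow_le (μ : PMF Γ) (m j : ℕ) : convPow μ m 1 ^ j ≤ convPow μ (m * j) 1 := by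
  classical
  induction j with
  | zero => simp [convPow_zero_apply]
  | succ j ih =>
    rw [pow_succ, mul_add, mul_one]
    calc _ ≤ convPow μ (m * j) 1 * convPow μ m 1 := by gcongr
      _ ≤ _ := by simpa using le_convPow_add μ (m * j) m 1 1

/-- Return probabilities are supermultiplicative, so along the multiples of `m` the roots in the
limsup stay above the `m`-th root of the return probability at time `m`. -/
lemma toReal_convPow_one_le_spectralRadius_pow (μ : PMF Γ) {m : ℕ} (hm : 0 < m) :
    (convPow μ m 1).toReal ≤ spectralRadius μ ^ m := by
  set a := (convPow μ m 1).toReal with ha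
  have ha0 : 0 ≤ a := ENNReal.toReal_nonneg
  have hm' : (0 : ℝ) < m := by exact_mod_cast hm
  have h : a ^ (1 / (m : ℝ)) ≤ spectralRadius μ := by
    refine le_limsup_of_frequently_le ?_ ?_
    · rw [frequently_atTop]
      intro N
      refine ⟨m * (N + 1), by nlinarith, ?_⟩
      have h1 : a ^ (N + 1) ≤ (convPow μ (m * (N + 1)) 1).toReal := by
        rw [ha, ← ENNReal.toReal_pow]
        exact ENNReal.toReal_mono (PMF.apply_ne_top _ _) (convPow_one_pow_le μ m (N + 1))
      have h2 : a ^ (1 / (m : ℝ)) = (a ^ (N + 1)) ^ (1 / ((m * (N + 1) : ℕ) : ℝ)) := by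
        rw [← Real.rpow_natCast, ← Real.rpow_mul ha0]
        congr 1
        push_cast
        field_simp
      rw [h2]
      exact Real.rpow_le_rpow (by positivity) h1 (by positivity)
    · exact ⟨1, eventually_map.2 (Eventually.of_forall fun n =>
        toReal_convPow_one_rpow_le_one μ n)⟩
  calc a = (a ^ (1 / (m : ℝ))) ^ m := by
        rw [← Real.rpow_natCast, ← Real.rpow_mul ha0, one_div_mul_cancel hm'.ne', Real.rpow_one]
    _ ≤ _ := pow_le_pow_left₀ (by positivity) h m

lemma tsum_convPow_sq {μ : PMF Γ} (hsymm : ∀ g, μ g⁻¹ = μ g) (m : ℕ) :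
    ∑' x, convPow μ m x ^ 2 = convPow μ (m + m) 1 := by
  rw [convPow_add_apply]
  refine tsum_congr fun x => ?_
  rw [mul_one, convPow_inv hsymm, sq]

lemma two_mul_le_sq_add_sq (a b : ℝ≥0∞) : 2 * a * b ≤ a ^ 2 + b ^ 2 := by
  wlog h : a ≤ b generalizing a b
  · have := this b a (le_of_not_ge h)
    rwa [mul_right_comm, add_comm]
  obtain ⟨d, rfl⟩ := exists_add_of_le h
  calc _ ≤ 2 * a * (a + d) + d ^ 2 := le_self_add
    _ = _ := by ring

/-- At even times the return probability is the maximum: Cauchy–Schwarz, in the form `2ab ≤ a² +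
b²`, where both sums of squares equal `μ^{*2m}(e)`. -/
lemma convPow_add_self_le {μ : PMF Γ} (hsymm : ∀ g, μ g⁻¹ = μ g) (m : ℕ) (y : Γ) :
    convPow μ (m + m) y ≤ convPow μ (m + m) 1 := by
  have h : 2 * convPow μ (m + m) y ≤ 2 * convPow μ (m + m) 1 := by
    calc _ = ∑' x, 2 * convPow μ m x * convPow μ m (x⁻¹ * y) := by
          rw [convPow_add_apply, ← ENNReal.tsum_mul_left]
          simp_rw [mul_assoc]
      _ ≤ ∑' x, (convPow μ m x ^ 2 + convPow μ m (x⁻¹ * y) ^ 2) :=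
          ENNReal.tsum_le_tsum fun x => two_mul_le_sq_add_sq _ _
      _ = _ := by
          rw [ENNReal.tsum_add, two_mul, tsum_convPow_sq hsymm]
          congr 1
          rw [← tsum_convPow_sq hsymm, ← (Equiv.divLeft y).tsum_eq]
          refine tsum_congr fun x => ?_
          rw [← convPow_inv hsymm m x]
          simp [div_eq_mul_inv, convPow_inv hsymm]
  exact (ENNReal.mul_le_mul_iff_right (by simp) (by simp)).1 h

lemma spectralRadius_pos {μ : PMF Γ} (hsymm : ∀ g, μ g⁻¹ = μ g) : 0 < spectralRadius μ := by
  have h := toReal_convPow_one_le_spectralRadius_pow μ (m := 2) two_pos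
  have hpos : 0 < (convPow μ 2 1).toReal := by
    refine ENNReal.toReal_pos ?_ (PMF.apply_ne_top _ _)
    obtain ⟨g, hg⟩ := μ.support_nonempty
    rw [PMF.mem_support_iff] at hg
    have := le_convPow_add μ 1 1 g⁻¹ g
    rw [convPow_one, inv_mul_cancel, hsymm] at this
    exact fun h0 => mul_ne_zero hg hg (le_antisymm (this.trans h0.le) zero_le)
  have h0 : 0 ≤ spectralRadius μ := by
    refine le_limsup_of_frequently_le
      (Frequently.of_forall fun n => Real.rpow_nonneg ENNReal.toReal_nonneg _)
      ⟨1, eventually_map.2 (Eventually.of_forall fun n => toReal_convPow_one_rpow_le_one μ n)⟩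
  refine h0.lt_of_ne fun h1 => ?_
  rw [← h1] at h
  norm_num at h
  linarith

/-- The quadratic form `⟨P^n f, f⟩` of a finitely supported function `f`, where `P` is the Markov
operator of the left random walk. -/
noncomputable def quadForm (μ : PMF Γ) (n : ℕ) (F : Finset Γ) (f : Γ → ℝ) : ℝ :=
  ∑ x ∈ F, ∑ z ∈ F, f x * f z * (convPow μ n (z * x⁻¹)).toReal

lemma sum_convPow_mul_convPow_le {μ : PMF Γ} (hsymm : ∀ g, μ g⁻¹ = μ g) (n : ℕ) (F : Finset Γ)
    (x y : Γ) :
    ∑ z ∈ F, (convPow μ n (z * x⁻¹)).toReal * (convPow μ n (z * y⁻¹)).toReal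
      ≤ (convPow μ (n + n) (y * x⁻¹)).toReal := by
  simp_rw [← ENNReal.toReal_mul]
  rw [← ENNReal.toReal_sum fun z _ => ENNReal.mul_ne_top (PMF.apply_ne_top _ _)
    (PMF.apply_ne_top _ _)]
  refine ENNReal.toReal_mono (PMF.apply_ne_top _ _) ?_
  rw [convPow_add_apply, ← ((Equiv.inv Γ).trans (Equiv.mulLeft y)).tsum_eq]
  refine (ENNReal.sum_le_tsum F).trans (le_of_eq (tsum_congr fun z => ?_))
  rw [mul_comm, ← convPow_inv hsymm n (z * y⁻¹)]
  simp

/-- Cauchy–Schwarz: `⟨Pⁿf, f⟩² ≤ ‖f‖² ‖Pⁿf‖²`, and `‖Pⁿf‖² = ⟨P²ⁿf, f⟩` by symmetry. Restricting the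
norm of `Pⁿf` to `F` only decreases it. -/
lemma quadForm_sq_le {μ : PMF Γ} (hsymm : ∀ g, μ g⁻¹ = μ g) (n : ℕ) (F : Finset Γ) {f : Γ → ℝ}
    (hf : ∀ x, 0 ≤ f x) :
    quadForm μ n F f ^ 2 ≤ (∑ x ∈ F, f x ^ 2) * quadForm μ (n + n) F f := by
  have h1 : quadForm μ n F f = ∑ z ∈ F, f z * ∑ x ∈ F, f x * (convPow μ n (z * x⁻¹)).toReal := by
    rw [quadForm, Finset.sum_comm]
    refine Finset.sum_congr rfl fun z _ => ?_
    rw [Finset.mul_sum]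
    exact Finset.sum_congr rfl fun x _ => by ring
  rw [h1]
  refine (Finset.sum_mul_sq_le_sq_mul_sq _ _ _).trans ?_
  refine mul_le_mul_of_nonneg_left ?_ (Finset.sum_nonneg fun x _ => sq_nonneg _)
  calc _ = ∑ x ∈ F, ∑ y ∈ F, f x * f y *
          ∑ z ∈ F, (convPow μ n (z * x⁻¹)).toReal * (convPow μ n (z * y⁻¹)).toReal := by
        simp_rw [sq, Finset.sum_mul_sum, Finset.mul_sum]
        rw [Finset.sum_comm]
        refine Finset.sum_congr rfl fun x _ => ?_
        rw [Finset.sum_comm]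
        exact Finset.sum_congr rfl fun y _ => Finset.sum_congr rfl fun z _ => by ring
    _ ≤ _ := Finset.sum_le_sum fun x _ => Finset.sum_le_sum fun y _ =>
        mul_le_mul_of_nonneg_left (sum_convPow_mul_convPow_le hsymm n F x y)
          (mul_nonneg (hf x) (hf y))

lemma le_of_forall_pow_two_pow_le {a r C : ℝ} (hr : 0 < r)
    (h : ∀ k : ℕ, a ^ 2 ^ (k + 1) ≤ C * r ^ 2 ^ (k + 1)) : a ≤ r := by
  by_contra! hlt
  have h1 : 1 < a / r := (one_lt_div hr).2 hlt
  obtain ⟨n, hn⟩ := pow_unbounded_of_one_lt C h1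
  have h2 : n ≤ 2 ^ (n + 1) := (Nat.lt_two_pow_self.le).trans (Nat.pow_le_pow_right two_pos n.le_succ)
  have h3 := hn.trans_le (pow_le_pow_right₀ h1.le h2)
  rw [div_pow, lt_div_iff₀ (by positivity)] at h3
  exact absurd (h n) (not_le.2 h3)

/-- The quadratic form of the Markov operator is bounded by the spectral radius. -/
lemma quadForm_one_le {μ : PMF Γ} (hsymm : ∀ g, μ g⁻¹ = μ g) (F : Finset Γ) {f : Γ → ℝ}
    (hf : ∀ x, 0 ≤ f x) :
    quadForm μ 1 F f ≤ spectralRadius μ * ∑ x ∈ F, f x ^ 2 := by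
  set N := ∑ x ∈ F, f x ^ 2 with hN
  have hN0 : 0 ≤ N := Finset.sum_nonneg fun x _ => sq_nonneg _
  have hq0 : ∀ n, 0 ≤ quadForm μ n F f := fun n => Finset.sum_nonneg fun x _ =>
    Finset.sum_nonneg fun z _ => mul_nonneg (mul_nonneg (hf x) (hf z)) ENNReal.toReal_nonneg
  rcases hN0.eq_or_lt with h0 | hpos
  · have := quadForm_sq_le hsymm 1 F hf
    rw [← hN, ← h0, zero_mul] at this
    rw [← h0, mul_zero]
    nlinarith
  have hρ := spectralRadius_pos hsymm
  -- Repeated doubling of the time by Cauchy–Schwarz replaces any appeal to the spectral theorem.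
  have hpow : ∀ k : ℕ, (quadForm μ 1 F f / N) ^ 2 ^ k ≤ quadForm μ (2 ^ k) F f / N := by
    intro k
    induction k with
    | zero => simp
    | succ k ih =>
      have h1 := quadForm_sq_le hsymm (2 ^ k) F hf
      calc _ = ((quadForm μ 1 F f / N) ^ 2 ^ k) ^ 2 := by rw [← pow_mul, pow_succ]
        _ ≤ (quadForm μ (2 ^ k) F f / N) ^ 2 :=
          pow_le_pow_left₀ (pow_nonneg (div_nonneg (hq0 1) hN0) _) ih 2
        _ ≤ _ := by
          rw [div_pow, div_le_div_iff₀ (by positivity) hpos, pow_succ 2 k, mul_two]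
          nlinarith
  -- The exponent `k + 1` makes the time even, so each coefficient is at most the return
  -- probability. The prefactor does not depend on `k` and disappears on taking roots.
  have hbd : ∀ k : ℕ, quadForm μ (2 ^ (k + 1)) F f
      ≤ (∑ x ∈ F, ∑ z ∈ F, f x * f z) * spectralRadius μ ^ 2 ^ (k + 1) := by
    intro k
    simp_rw [Finset.sum_mul]
    refine Finset.sum_le_sum fun x _ => Finset.sum_le_sum fun z _ =>
      mul_le_mul_of_nonneg_left ?_ (mul_nonneg (hf x) (hf z))
    refine le_trans ?_ (toReal_convPow_one_le_spectralRadius_pow μ (by positivity))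
    refine ENNReal.toReal_mono (PMF.apply_ne_top _ _) ?_
    rw [pow_succ, mul_two]
    exact convPow_add_self_le hsymm _ _
  rw [← div_le_iff₀ hpos]
  refine le_of_forall_pow_two_pow_le (C := (∑ x ∈ F, ∑ z ∈ F, f x * f z) / N) hρ fun k => ?_
  refine (hpow (k + 1)).trans ?_
  rw [div_mul_eq_mul_div]
  exact div_le_div_of_nonneg_right (hbd k) hN0

/-- The Bhattacharyya coefficient of a probability measure and its translates, averaged over `μ`,
is at most the spectral radius. -/
lemma sum_mul_sqrt_le_spectralRadius {μ : PMF Γ} (hsymm : ∀ g, μ g⁻¹ = μ g) {q : Γ → ℝ}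
    (hq : ∀ x, 0 ≤ q x) (hq1 : HasSum q 1) (S : Finset (Γ × Γ)) :
    ∑ p ∈ S, (μ p.1).toReal * √(q p.2 * q (p.1 * p.2)) ≤ spectralRadius μ := by
  classical
  set F : Finset Γ := S.image (fun p => p.2) ∪ S.image (fun p => p.1 * p.2) with hF
  have h1 := quadForm_one_le hsymm F (f := fun x => √(q x)) (fun x => Real.sqrt_nonneg _)
  have h2 : ∑ x ∈ F, √(q x) ^ 2 ≤ 1 := by
    simp_rw [Real.sq_sqrt (hq _)]
    exact sum_le_hasSum F (fun x _ => hq x) hq1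
  refine le_trans ?_ (h1.trans (mul_le_of_le_one_right (spectralRadius_pos hsymm).le h2))
  rw [quadForm, ← Finset.sum_product', convPow_one]
  -- An edge is determined by its endpoints, so the sum over `S` is part of the double sum over `F ×
  -- F`, whose terms are nonnegative.
  have hinj : Set.InjOn (fun p : Γ × Γ => (p.2, p.1 * p.2)) S := by
    rintro ⟨a, b⟩ _ ⟨c, d⟩ _ h
    simp only [Prod.mk.injEq] at h
    obtain ⟨rfl, h⟩ := h
    simpa using h
  calc _ = ∑ p ∈ S.image (fun p : Γ × Γ => (p.2, p.1 * p.2)),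
          √(q p.1) * √(q p.2) * (μ (p.2 * p.1⁻¹)).toReal := by
        rw [Finset.sum_image hinj]
        refine Finset.sum_congr rfl fun p _ => ?_
        rw [Real.sqrt_mul (hq _), mul_inv_cancel_right, mul_comm]
    _ ≤ _ := by
        refine Finset.sum_le_sum_of_subset_of_nonneg ?_ fun p _ _ => by positivity
        intro p hp
        obtain ⟨r, hr, rfl⟩ := Finset.mem_image.1 hp
        exact Finset.mem_product.2 ⟨Finset.mem_union_left _ (Finset.mem_image.2 ⟨r, hr, rfl⟩),
          Finset.mem_union_right _ (Finset.mem_image.2 ⟨r, hr, rfl⟩)⟩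

end SpectralRadius

/-! ### The function `A` and the inequality for weights on edges. -/

section RateFunction

lemma A_zero : A 0 = 0 := by simp [A]

lemma continuous_A : Continuous A := by
  have h := Real.continuous_mul_log
  exact (h.comp (continuous_const.add continuous_id)).add
    (h.comp (continuous_const.sub continuous_id))

lemma monotoneOn_A : MonotoneOn A (Set.Icc 0 1) := by
  have hd : ∀ x ∈ Set.Ioo (0 : ℝ) 1, HasDerivAt A (Real.log (1 + x) - Real.log (1 - x)) x := by
    intro x hx
    have h1 := (Real.hasDerivAt_mul_log (x := 1 + x) (by linarith [hx.1])).comp x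
      ((hasDerivAt_id x).const_add 1)
    have h2 := (Real.hasDerivAt_mul_log (x := 1 - x) (by linarith [hx.2])).comp x
      ((hasDerivAt_id x).const_sub 1)
    convert! h1.add h2 using 1
    ring
  refine monotoneOn_of_deriv_nonneg (convex_Icc 0 1) continuous_A.continuousOn ?_ ?_
  · rw [interior_Icc]
    exact fun x hx => (hd x hx).differentiableAt.differentiableWithinAt
  · rw [interior_Icc]
    intro x hx
    rw [(hd x hx).deriv, sub_nonneg]
    exact Real.log_le_log (by linarith [hx.2]) (by linarith [hx.1])

lemma A_nonneg {x : ℝ} (hx : x ∈ Set.Icc (0 : ℝ) 1) : 0 ≤ A x :=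
  A_zero ▸ monotoneOn_A ⟨le_rfl, zero_le_one⟩ hx hx.1

/-- Expand `A x = x log((1+x)/(1-x)) + log(1-x²)`. All coefficients in powers of `x²` are
nonnegative, which is what makes `A (√y)` convex and nondecreasing. -/
lemma hasSum_A {x : ℝ} (hx : |x| < 1) :
    HasSum (fun k : ℕ => (x ^ 2) ^ (k + 1) / ((k + 1) * (2 * k + 1))) (A x) := by
  have hx2 : |x ^ 2| < 1 := by
    rw [abs_pow]
    exact pow_lt_one₀ (abs_nonneg x) hx two_ne_zero
  obtain ⟨h1, h2⟩ := abs_lt.1 hx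
  have hs := ((Real.hasSum_log_sub_log_of_abs_lt_one hx).mul_left x).sub
    (Real.hasSum_pow_div_log_of_abs_lt_one hx2)
  convert! hs using 1
  · ext k
    have : (2 * (k : ℝ) + 1) ≠ 0 := by positivity
    have : ((k : ℝ) + 1) ≠ 0 := by positivity
    field_simp
    ring
  · have : (1 : ℝ) - x ^ 2 = (1 + x) * (1 - x) := by ring
    rw [this, Real.log_mul (by linarith) (by linarith), A]
    ring

/-- `A (√y)` is a convex nondecreasing function of `y`: it lies above its tangents. -/
lemma exists_A_tangent {x₀ : ℝ} (h0 : 0 ≤ x₀) (h1 : x₀ < 1) :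
    ∃ c, 0 ≤ c ∧ ∀ x, |x| < 1 → A x₀ + c * (x ^ 2 - x₀ ^ 2) ≤ A x := by
  have hx₀ : |x₀| < 1 := by rwa [abs_of_nonneg h0]
  have hgeom : Summable fun k : ℕ => (x₀ ^ 2) ^ k :=
    summable_geometric_of_lt_one (by positivity) (pow_lt_one₀ h0 h1 two_ne_zero)
  have hc : Summable fun k : ℕ => (x₀ ^ 2) ^ k / (2 * k + 1) := by
    refine Summable.of_nonneg_of_le (fun k => by positivity) (fun k => ?_) hgeom
    exact div_le_self (by positivity) (by linarith [k.cast_nonneg (α := ℝ)])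
  -- The slope is the derivative of the series in `y = x²` at `x₀²`; each power `y^(k+1)` lies above
  -- its own tangent.
  refine ⟨∑' k : ℕ, (x₀ ^ 2) ^ k / (2 * k + 1), tsum_nonneg fun k => by positivity, fun x hx => ?_⟩
  refine hasSum_le (fun k => ?_) ((hasSum_A hx₀).add (hc.hasSum.mul_right _)) (hasSum_A hx)
  have hconv : (x₀ ^ 2) ^ (k + 1) + (k + 1) * (x₀ ^ 2) ^ k * (x ^ 2 - x₀ ^ 2)
      ≤ (x ^ 2) ^ (k + 1) := by
    have ha : 0 ≤ x₀ ^ 2 := sq_nonneg _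
    have hb : 0 ≤ x ^ 2 := sq_nonneg _
    generalize x₀ ^ 2 = a at ha ⊢
    generalize x ^ 2 = b at hb ⊢
    induction k with
    | zero => simp
    | succ k ih =>
      have h2 := mul_le_mul_of_nonneg_left ih hb
      have h3 : 0 ≤ (k + 1) * a ^ k * (b - a) ^ 2 := by positivity
      push_cast
      ring_nf at h2 h3 ⊢
      linarith
  have h2 := div_le_div_of_nonneg_right hconv
    (show (0 : ℝ) ≤ (k + 1) * (2 * k + 1) by positivity)
  refine le_trans (le_of_eq ?_) h2
  field_simp

/-- The pointwise form of the entropy inequality, for two weights `u, v` and a displacement `b`. -/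
lemma rate_pointwise {u v : ℝ} (hu : 0 ≤ u) (hv : 0 ≤ v) (huv : u = 0 ↔ v = 0) {x₀ c : ℝ}
    (hc : 0 ≤ c) (htan : ∀ x, |x| < 1 → A x₀ + c * (x ^ 2 - x₀ ^ 2) ≤ A x) {ρ : ℝ} (hρ : 0 < ρ)
    (t b : ℝ) :
    (u + v) * ((A x₀ - c * x₀ ^ 2) - 2 * Real.log ρ + 2) + 2 * c * t * (u * b - v * b)
        - c * t ^ 2 * (u * b ^ 2 + v * b ^ 2) - 4 / ρ * √(u * v)
      ≤ u * (Real.log u - Real.log v) - v * (Real.log u - Real.log v) := by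
  rcases hu.eq_or_lt with h0 | hu'
  · have hv0 := huv.1 h0.symm
    simp [← h0, hv0]
  have hv' : 0 < v := hv.lt_of_ne fun h => hu'.ne' (huv.2 h.symm)
  have hπ : 0 < u + v := by linarith
  set T := (u - v) / (u + v) with hT
  have e1 : 1 + T = 2 * u / (u + v) := by rw [hT]; field_simp; ring
  have e2 : 1 - T = 2 * v / (u + v) := by rw [hT]; field_simp; ring
  have p1 : 0 < 1 + T := by rw [e1]; positivity
  have p2 : 0 < 1 - T := by rw [e2]; positivity
  have hTabs : |T| < 1 := abs_lt.2 ⟨by linarith, by linarith⟩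
  have hπT : (u + v) * T = u - v := by rw [hT]; field_simp
  have hsq : √(1 - T ^ 2) = 2 * √(u * v) / (u + v) := by
    rw [Real.sqrt_eq_iff_mul_self_eq (by nlinarith) (by positivity)]
    have : √(u * v) * √(u * v) = u * v := Real.mul_self_sqrt (by positivity)
    have e3 : 1 - T ^ 2 = (1 + T) * (1 - T) := by ring
    rw [e3, e1, e2]
    field_simp
    linarith
  have hsqpos : 0 < √(1 - T ^ 2) := Real.sqrt_pos.2 (by nlinarith)
  have hA := htan T hTabs
  -- The tangent to `log` at `ρ`, applied to `√(1 - T²)`.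
  have hlog : 2 - 2 * Real.log ρ - 2 * (√(1 - T ^ 2) / ρ) ≤ -Real.log (1 - T ^ 2) := by
    have h := Real.log_le_sub_one_of_pos (div_pos hsqpos hρ)
    rw [Real.log_div hsqpos.ne' hρ.ne', Real.log_sqrt (by nlinarith)] at h
    linarith
  -- From `(T - t b)² ≥ 0`: the quadratic `T²` is linearised in the direction of the displacement.
  have hTb : 2 * t * (T * b) - t ^ 2 * b ^ 2 ≤ T ^ 2 := by nlinarith [sq_nonneg (T - t * b)]
  have hmain : u * (Real.log u - Real.log v) - v * (Real.log u - Real.log v)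
      = (u + v) * (A T - Real.log (1 - T ^ 2)) := by
    have e3 : 1 - T ^ 2 = (1 + T) * (1 - T) := by ring
    have e4 : A T - Real.log (1 - T ^ 2) = T * (Real.log (1 + T) - Real.log (1 - T)) := by
      rw [e3, Real.log_mul p1.ne' p2.ne', A]
      ring
    have e5 : Real.log (1 + T) - Real.log (1 - T) = Real.log u - Real.log v := by
      rw [e1, e2, Real.log_div (by positivity) hπ.ne', Real.log_div (by positivity) hπ.ne',
        Real.log_mul two_ne_zero hu'.ne', Real.log_mul two_ne_zero hv'.ne']
      ring
    rw [e4, e5, ← mul_assoc, hπT]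
    ring
  have hcT := mul_le_mul_of_nonneg_left hTb hc
  have hfin := mul_le_mul_of_nonneg_left (show A x₀ - c * x₀ ^ 2 - 2 * Real.log ρ + 2
      + c * (2 * t * (T * b) - t ^ 2 * b ^ 2) - 2 * (√(1 - T ^ 2) / ρ)
      ≤ A T - Real.log (1 - T ^ 2) by linarith) hπ.le
  rw [hmain]
  refine le_trans (le_of_eq ?_) hfin
  have e6 : (u + v) * (2 * (√(1 - T ^ 2) / ρ)) = 4 / ρ * √(u * v) := by
    rw [hsq]
    field_simp
    ring
  have e7 : (u + v) * (c * (2 * t * (T * b) - t ^ 2 * b ^ 2))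
      = 2 * c * t * (u * b - v * b) - c * t ^ 2 * (u * b ^ 2 + v * b ^ 2) := by
    linear_combination 2 * c * t * b * hπT
  linear_combination e6 - e7

/-- A lower bound for the relative entropy of a probability weight `u` with respect to its image
under an involution. -/
lemma rate_le_relative_entropy {ι : Type*} (τ : ι ≃ ι) (hτ : ∀ i, τ (τ i) = i) {u b : ι → ℝ}
    (hu : ∀ i, 0 ≤ u i) (hu0 : ∀ i, u i = 0 ↔ u (τ i) = 0) (hb : ∀ i, b (τ i) = -b i)
    (hu1 : HasSum u 1) {d V R h x₀ M ρ : ℝ}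
    (hd : HasSum (fun i => u i * b i) d) (hV : HasSum (fun i => u i * b i ^ 2) V)
    (hR : HasSum (fun i => √(u i * u (τ i))) R)
    (hh : HasSum (fun i => u i * (Real.log (u i) - Real.log (u (τ i)))) h)
    (hVM : V ≤ M ^ 2) (hρ : 0 < ρ) (hRρ : R ≤ ρ) (hx₀ : 0 ≤ x₀) (hx₁ : x₀ < 1)
    (hxd : x₀ ≤ d / M) :
    A x₀ - 2 * Real.log ρ ≤ h := by
  obtain ⟨c, hc, htan⟩ := exists_A_tangent hx₀ hx₁
  have hv1 : HasSum (fun i => u (τ i)) 1 := τ.hasSum_iff.2 hu1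
  have hvd : HasSum (fun i => u (τ i) * b i) (-d) := by
    have := (τ.hasSum_iff.2 hd).neg
    simpa [Function.comp_def, hb] using this
  have hvV : HasSum (fun i => u (τ i) * b i ^ 2) V := by
    have := τ.hasSum_iff.2 hV
    simpa [Function.comp_def, hb] using this
  have hvh : HasSum (fun i => u (τ i) * (Real.log (u i) - Real.log (u (τ i)))) (-h) := by
    have := (τ.hasSum_iff.2 hh).neg
    simp only [Function.comp_def, hτ] at this
    convert! this using 2
    ring
  -- Summing over edges and using the involution, the right side becomes `2h`, the total mass of `u
  -- + v` is `2`, and the odd displacement contributes `2d`. The choice `t = x₀ / M` makes the terms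
  -- in `c` cancel favourably; if `M = 0`, division by zero forces `x₀ = 0`.
  have hle := hasSum_le
    (fun i => rate_pointwise (hu i) (hu (τ i)) (hu0 i) hc htan hρ (x₀ / M) (b i))
    (((((hu1.add hv1).mul_right _).add ((hd.sub hvd).mul_left _)).sub
      ((hV.add hvV).mul_left _)).sub (hR.mul_left _)) (hh.sub hvh)
  have h1 : x₀ ^ 2 ≤ x₀ / M * d := by
    rw [div_mul_eq_mul_div, mul_div_assoc, sq]
    exact mul_le_mul_of_nonneg_left hxd hx₀
  have h2 : (x₀ / M) ^ 2 * V ≤ x₀ ^ 2 := by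
    rw [div_pow, div_mul_eq_mul_div, mul_div_assoc]
    refine mul_le_of_le_one_right (sq_nonneg _) (div_le_one_of_le₀ hVM (sq_nonneg _))
  have h3 : 4 / ρ * R ≤ 4 := by
    rw [div_mul_eq_mul_div, div_le_iff₀ hρ]
    linarith
  have h4 := mul_le_mul_of_nonneg_left h1 hc
  have h5 := mul_le_mul_of_nonneg_left h2 hc
  nlinarith

end RateFunction

/-! ### Length, drift and second moment. -/

section Length

variable {Γ : Type*} [Group Γ] [MetricSpace Γ]

lemma length_nonneg (g : Γ) : 0 ≤ length g := dist_nonneg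

lemma length_one : length (1 : Γ) = 0 := dist_self 1

lemma length_mul_le (hleft : ∀ g x y : Γ, dist (g * x) (g * y) = dist x y)
    (x y : Γ) : length (x * y) ≤ length x + length y := by
  have h1 := dist_triangle (x * y) x 1
  have h2 := hleft x y 1
  rw [mul_one] at h2
  simp only [length]
  linarith

lemma length_inv (hleft : ∀ g x y : Γ, dist (g * x) (g * y) = dist x y)
    (g : Γ) : length g⁻¹ = length g := by
  have h := hleft g g⁻¹ 1
  rw [mul_inv_cancel, mul_one] at h
  rw [length, ← h, dist_comm, length]

lemma abs_length_mul_sub_le (hleft : ∀ g x y : Γ, dist (g * x) (g * y) = dist x y)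
    (g x : Γ) : |length (g * x) - length x| ≤ length g := by
  have h1 := length_mul_le hleft g x
  have h2 := length_mul_le hleft g⁻¹ (g * x)
  rw [inv_mul_cancel_left, length_inv hleft] at h2
  exact abs_le.2 ⟨by linarith, by linarith⟩

lemma toReal_tsum_mul_length (μ : PMF Γ) (n : ℕ) :
    (∑' g, convPow μ n g * ENNReal.ofReal (length g)).toReal = meanLength μ n := by
  rw [ENNReal.tsum_toReal_eq fun g => ENNReal.mul_ne_top (PMF.apply_ne_top _ _)
    ENNReal.ofReal_ne_top]
  refine tsum_congr fun g => ?_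
  rw [ENNReal.toReal_mul, ENNReal.toReal_ofReal (length_nonneg g), mul_comm]

lemma tsum_convPow_add_mul_length_le (hleft : ∀ g x y : Γ, dist (g * x) (g * y) = dist x y)
    (μ : PMF Γ) (m n : ℕ) :
    ∑' g, convPow μ (m + n) g * ENNReal.ofReal (length g)
      ≤ ∑' g, convPow μ m g * ENNReal.ofReal (length g)
        + ∑' g, convPow μ n g * ENNReal.ofReal (length g) := by
  rw [tsum_convPow_add_mul]
  calc _ ≤ ∑' x, ∑' z, convPow μ m x * convPow μ n z *
          (ENNReal.ofReal (length x) + ENNReal.ofReal (length z)) := by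
        refine ENNReal.tsum_le_tsum fun x => ENNReal.tsum_le_tsum fun z => ?_
        rw [← ENNReal.ofReal_add (length_nonneg x) (length_nonneg z)]
        exact mul_le_mul' le_rfl (ENNReal.ofReal_le_ofReal (length_mul_le hleft x z))
    _ = ∑' x, (convPow μ m x * ENNReal.ofReal (length x) * ∑' z, convPow μ n z +
          convPow μ m x * ∑' z, convPow μ n z * ENNReal.ofReal (length z)) := by
        refine tsum_congr fun x => ?_
        rw [← ENNReal.tsum_mul_left, ← ENNReal.tsum_mul_left, ← ENNReal.tsum_add]
        exact tsum_congr fun z => by ring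
    _ = _ := by
        rw [ENNReal.tsum_add, ENNReal.tsum_mul_right, ENNReal.tsum_mul_right, PMF.tsum_coe,
          PMF.tsum_coe, mul_one, one_mul]

lemma summable_length_mul {μ : PMF Γ}
    (hmoment : Summable fun g : Γ => length g ^ 2 * (μ g).toReal) :
    Summable fun g => length g * (μ g).toReal := by
  refine Summable.of_nonneg_of_le (fun g => mul_nonneg (length_nonneg g) ENNReal.toReal_nonneg)
    (fun g => ?_) (hmoment.add (ENNReal.summable_toReal μ.tsum_coe_ne_top))
  rw [← add_one_mul]
  exact mul_le_mul_of_nonneg_right (by nlinarith [sq_nonneg (length g - 1)])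
    ENNReal.toReal_nonneg

lemma tsum_convPow_mul_length_le (hleft : ∀ g x y : Γ, dist (g * x) (g * y) = dist x y)
    (μ : PMF Γ) (n : ℕ) :
    ∑' g, convPow μ n g * ENNReal.ofReal (length g)
      ≤ n * ∑' g, μ g * ENNReal.ofReal (length g) := by
  classical
  induction n with
  | zero =>
    rw [tsum_eq_single 1]
    · simp [length_one]
    · intro g hg
      simp [convPow_zero_apply, hg]
  | succ n ih =>
    refine (tsum_convPow_add_mul_length_le hleft μ n 1).trans ?_
    rw [convPow_one]
    push_cast
    rw [add_mul, one_mul]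
    gcongr

lemma tsum_mul_length_ne_top {μ : PMF Γ}
    (hmoment : Summable fun g : Γ => length g ^ 2 * (μ g).toReal) :
    ∑' g, μ g * ENNReal.ofReal (length g) ≠ ⊤ := by
  convert! (summable_length_mul hmoment).tsum_ofReal_ne_top using 3
  rw [mul_comm, ENNReal.ofReal_mul (length_nonneg _), ENNReal.ofReal_toReal (μ.apply_ne_top _)]

lemma tsum_convPow_mul_length_ne_top (hleft : ∀ g x y : Γ, dist (g * x) (g * y) = dist x y)
    {μ : PMF Γ}
    (hmoment : Summable fun g : Γ => length g ^ 2 * (μ g).toReal) (n : ℕ) :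
    ∑' g, convPow μ n g * ENNReal.ofReal (length g) ≠ ⊤ :=
  ne_top_of_le_ne_top (ENNReal.mul_ne_top (ENNReal.natCast_ne_top n)
    (tsum_mul_length_ne_top hmoment)) (tsum_convPow_mul_length_le hleft μ n)

lemma summable_length_mul_convPow (hleft : ∀ g x y : Γ, dist (g * x) (g * y) = dist x y)
    {μ : PMF Γ}
    (hmoment : Summable fun g : Γ => length g ^ 2 * (μ g).toReal) (n : ℕ) :
    Summable fun g => length g * (convPow μ n g).toReal := by
  convert! ENNReal.summable_toReal (tsum_convPow_mul_length_ne_top hleft hmoment n) using 2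
  rw [ENNReal.toReal_mul, ENNReal.toReal_ofReal (length_nonneg _), mul_comm]

lemma tendsto_drift_and_le (hleft : ∀ g x y : Γ, dist (g * x) (g * y) = dist x y)
    {μ : PMF Γ}
    (hmoment : Summable fun g : Γ => length g ^ 2 * (μ g).toReal) :
    Tendsto (fun n : ℕ => meanLength μ n / (n : ℝ)) atTop (𝓝 (drift μ)) ∧
      ∀ n : ℕ, n * drift μ ≤ meanLength μ n := by
  obtain ⟨l, hl, hle⟩ := tendsto_div_of_subadditive (a := meanLength μ)
    (fun n => tsum_nonneg fun g => mul_nonneg (length_nonneg g) ENNReal.toReal_nonneg) (by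
      intro m n
      have h := tsum_convPow_mul_length_ne_top hleft hmoment
      simp_rw [← toReal_tsum_mul_length]
      rw [← ENNReal.toReal_add (h m) (h n)]
      exact ENNReal.toReal_mono (ENNReal.add_ne_top.2 ⟨h m, h n⟩)
        (tsum_convPow_add_mul_length_le hleft μ m n))
  have : drift μ = l := hl.limUnder_eq
  rw [this]
  exact ⟨hl, hle⟩

lemma drift_nonneg (hleft : ∀ g x y : Γ, dist (g * x) (g * y) = dist x y)
    {μ : PMF Γ}
    (hmoment : Summable fun g : Γ => length g ^ 2 * (μ g).toReal) : 0 ≤ drift μ :=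
  ge_of_tendsto' (tendsto_drift_and_le hleft hmoment).1 fun n =>
    div_nonneg (tsum_nonneg fun g => mul_nonneg (length_nonneg g) ENNReal.toReal_nonneg)
      n.cast_nonneg

lemma hasSum_toReal_coe {Ω : Type*} (μ : PMF Ω) : HasSum (fun g => (μ g).toReal) 1 := by
  have := ENNReal.hasSum_toReal μ.tsum_coe_ne_top
  rwa [← ENNReal.tsum_toReal_eq μ.apply_ne_top, μ.tsum_coe, ENNReal.toReal_one] at this

lemma M₂_sq (μ : PMF Γ) : M₂ μ ^ 2 = ∑' g, length g ^ 2 * (μ g).toReal :=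
  Real.sq_sqrt (tsum_nonneg fun _ => mul_nonneg (sq_nonneg _) ENNReal.toReal_nonneg)

/-- By subadditivity `ℓ` is at most the mean length at time `1`, and nonnegativity of the variance
bounds that mean by `M₂`. -/
lemma drift_le_M₂ (hleft : ∀ g x y : Γ, dist (g * x) (g * y) = dist x y)
    {μ : PMF Γ}
    (hmoment : Summable fun g : Γ => length g ^ 2 * (μ g).toReal) : drift μ ≤ M₂ μ := by
  have h1 := (tendsto_drift_and_le hleft hmoment).2 1
  rw [Nat.cast_one, one_mul] at h1
  refine h1.trans (Real.le_sqrt_of_sq_le ?_)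
  have hL : HasSum (fun g => length g * (μ g).toReal) (meanLength μ 1) := by
    rw [meanLength, convPow_one]
    exact (summable_length_mul hmoment).hasSum
  have := hasSum_le (fun g => ?_) (hL.mul_left (2 * meanLength μ 1))
    (hmoment.hasSum.add ((hasSum_toReal_coe μ).mul_left (meanLength μ 1 ^ 2)))
  · nlinarith
  · have h := mul_nonneg (sq_nonneg (length g - meanLength μ 1))
      (ENNReal.toReal_nonneg (a := μ g))
    nlinarith

lemma M₂_le {μ : PMF Γ} (hmoment : Summable fun g : Γ => length g ^ 2 * (μ g).toReal) {k : ℝ}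
    (hk0 : 0 ≤ k) (hk : ∀ g : Γ, μ g ≠ 0 → length g ≤ k) : M₂ μ ≤ k := by
  refine Real.sqrt_le_iff.2 ⟨hk0, ?_⟩
  rw [← mul_one (k ^ 2)]
  refine hasSum_le (fun g => ?_) hmoment.hasSum ((hasSum_toReal_coe μ).mul_left (k ^ 2))
  rcases eq_or_ne (μ g) 0 with h0 | h0
  · simp [h0]
  · exact mul_le_mul_of_nonneg_right (pow_le_pow_left₀ (length_nonneg g) (hk g h0) 2)
      ENNReal.toReal_nonneg

end Length

/-! ### The walk at an independent geometric time. -/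

section GeometricMixture

/-- The weights of the geometric law of parameter `1 - s`. -/
noncomputable def geomWeight (s : ℝ) (n : ℕ) : ℝ≥0∞ := ENNReal.ofReal ((1 - s) * s ^ n)

variable {s : ℝ}

lemma tsum_geomWeight (hs0 : 0 < s) (hs1 : s < 1) : ∑' n, geomWeight s n = 1 := by
  have h := (hasSum_geometric_of_lt_one hs0.le hs1).mul_left (1 - s)
  have h1 : 0 < 1 - s := by linarith
  simp_rw [geomWeight]
  rw [← ENNReal.ofReal_tsum_of_nonneg (fun n => by positivity) h.summable, h.tsum_eq,
    mul_inv_cancel₀ h1.ne', ENNReal.ofReal_one]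

lemma tsum_geomWeight_mul_natCast (hs0 : 0 < s) (hs1 : s < 1) :
    ∑' n : ℕ, geomWeight s n * n = ENNReal.ofReal (s / (1 - s)) := by
  have h1 : 0 < 1 - s := by linarith
  have h := (hasSum_coe_mul_geometric_of_norm_lt_one (r := s)
    (by rwa [Real.norm_eq_abs, abs_of_pos hs0])).mul_left (1 - s)
  have e : ∀ n : ℕ, geomWeight s n * n = ENNReal.ofReal ((1 - s) * (n * s ^ n)) := by
    intro n
    rw [geomWeight, ← ENNReal.ofReal_natCast n, ← ENNReal.ofReal_mul (by positivity)]
    congr 1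
    ring
  simp_rw [e]
  rw [← ENNReal.ofReal_tsum_of_nonneg (fun n => by positivity) h.summable, h.tsum_eq]
  congr 1
  field_simp

lemma geomWeight_le_one (hs0 : 0 < s) (hs1 : s < 1) (n : ℕ) : geomWeight s n ≤ 1 :=
  tsum_geomWeight hs0 hs1 ▸ ENNReal.le_tsum n

lemma geomWeight_succ (hs0 : 0 < s) (n : ℕ) :
    geomWeight s (n + 1) = ENNReal.ofReal s * geomWeight s n := by
  rw [geomWeight, geomWeight, ← ENNReal.ofReal_mul hs0.le]
  congr 1
  ring

lemma surprisal_geomWeight_le (hs0 : 0 < s) (hs1 : s < 1) (n : ℕ) :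
    surprisal (geomWeight s n)
      ≤ ENNReal.ofReal (-Real.log (1 - s)) + n * ENNReal.ofReal (-Real.log s) := by
  have h1 : 0 < 1 - s := by linarith
  have h2 := Real.log_nonpos hs0.le hs1.le
  rw [surprisal, geomWeight, ENNReal.toReal_ofReal (by positivity),
    Real.log_mul h1.ne' (by positivity), Real.log_pow, neg_add, ← mul_neg]
  refine ENNReal.ofReal_add_le.trans ?_
  rw [ENNReal.ofReal_mul n.cast_nonneg, ENNReal.ofReal_natCast]

variable {Γ : Type*} [Group Γ]

/-- The law of the random walk stopped at an independent geometric time. -/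
noncomputable def geomMixture (μ : PMF Γ) (s : ℝ) (y : Γ) : ℝ≥0∞ :=
  ∑' n, geomWeight s n * convPow μ n y

lemma tsum_geomMixture_mul (μ : PMF Γ) (s : ℝ) (F : Γ → ℝ≥0∞) :
    ∑' y, geomMixture μ s y * F y = ∑' n, geomWeight s n * ∑' y, convPow μ n y * F y := by
  simp_rw [geomMixture, ← ENNReal.tsum_mul_right, ← ENNReal.tsum_mul_left]
  rw [ENNReal.tsum_comm]
  simp_rw [mul_assoc]

lemma tsum_geomMixture (μ : PMF Γ) (hs0 : 0 < s) (hs1 : s < 1) :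
    ∑' y, geomMixture μ s y = 1 := by
  have := tsum_geomMixture_mul μ s fun _ => 1
  simpa [PMF.tsum_coe, tsum_geomWeight hs0 hs1] using this

lemma geomMixture_le_one (μ : PMF Γ) (hs0 : 0 < s) (hs1 : s < 1) (y : Γ) :
    geomMixture μ s y ≤ 1 :=
  tsum_geomMixture μ hs0 hs1 ▸ ENNReal.le_tsum y

lemma geomMixture_ne_top (μ : PMF Γ) (hs0 : 0 < s) (hs1 : s < 1) (y : Γ) :
    geomMixture μ s y ≠ ⊤ :=
  ne_top_of_le_ne_top ENNReal.one_ne_top (geomMixture_le_one μ hs0 hs1 y)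

/-- Either the clock stops at time `0`, or a first increment is split off on the left and the
remaining time is again geometric. -/
lemma geomMixture_eq (μ : PMF Γ) (hs0 : 0 < s) (y : Γ) :
    geomMixture μ s y = ENNReal.ofReal (1 - s) * convPow μ 0 y
      + ENNReal.ofReal s * ∑' g, μ g * geomMixture μ s (g⁻¹ * y) := by
  rw [geomMixture, tsum_eq_zero_add' ENNReal.summable]
  congr 1
  · simp [geomWeight]
  · simp_rw [geomWeight_succ hs0, mul_assoc, geomMixture]
    rw [ENNReal.tsum_mul_left]
    congr 1
    simp_rw [← ENNReal.tsum_mul_left]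
    rw [ENNReal.tsum_comm]
    refine tsum_congr fun n => ?_
    rw [add_comm n 1, convPow_add_apply, convPow_one, ← ENNReal.tsum_mul_left]
    exact tsum_congr fun g => by ring

lemma tsum_geomMixture_mul_eq (μ : PMF Γ) (hs0 : 0 < s) (F : Γ → ℝ≥0∞) :
    ∑' y, geomMixture μ s y * F y = ENNReal.ofReal (1 - s) * F 1
      + ENNReal.ofReal s * ∑' p : Γ × Γ, μ p.1 * geomMixture μ s p.2 * F (p.1 * p.2) := by
  classical
  rw [ENNReal.tsum_prod', ← tsum_conv_mul, ← ENNReal.tsum_mul_left]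
  calc _ = ∑' y, (ENNReal.ofReal (1 - s) * (convPow μ 0 y * F y)
          + ENNReal.ofReal s * ((∑' g, μ g * geomMixture μ s (g⁻¹ * y)) * F y)) := by
        refine tsum_congr fun y => ?_
        rw [geomMixture_eq μ hs0 y]
        ring
    _ = _ := by
        rw [ENNReal.tsum_add, ENNReal.tsum_mul_left, tsum_eq_single 1]
        · simp [convPow_zero_apply]
        · intro y hy
          simp [convPow_zero_apply, hy]

lemma tsum_prod_mul_geomMixture_mul (μ : PMF Γ) (s : ℝ) (F : Γ → ℝ≥0∞) :
    ∑' p : Γ × Γ, μ p.1 * geomMixture μ s p.2 * F p.2 = ∑' y, geomMixture μ s y * F y := by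
  rw [ENNReal.tsum_prod']
  simp_rw [mul_assoc, ENNReal.tsum_mul_left, ENNReal.tsum_mul_right, PMF.tsum_coe, one_mul]

lemma geomMixture_mul_ne_zero (μ : PMF Γ) (hs0 : 0 < s) {g x : Γ} (hg : μ g ≠ 0)
    (hx : geomMixture μ s x ≠ 0) : geomMixture μ s (g * x) ≠ 0 := by
  rw [geomMixture_eq μ hs0]
  have h : μ g * geomMixture μ s x ≤ ∑' k, μ k * geomMixture μ s (k⁻¹ * (g * x)) := by
    refine le_trans (le_of_eq ?_) (ENNReal.le_tsum g)
    rw [inv_mul_cancel_left]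
  have h1 : ∑' k, μ k * geomMixture μ s (k⁻¹ * (g * x)) ≠ 0 := fun h0 =>
    mul_ne_zero hg hx (le_antisymm (h.trans h0.le) zero_le)
  have h2 : ENNReal.ofReal s ≠ 0 := by simpa using hs0
  exact fun h0 => mul_ne_zero h2 h1 (add_eq_zero.1 h0).2

/-- The entropy of the stopped position is at most the joint entropy of the time and the position.
The latter is the entropy of the geometric law plus the average of the entropies at fixed times; the
mean time is `s / (1 - s)`. -/
lemma tsum_geomMixture_mul_surprisal_le (μ : PMF Γ) (hs0 : 0 < s) (hs1 : s < 1) {C b : ℝ}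
    (hC : 0 ≤ C) (hb : 0 ≤ b) (hH : ∀ n : ℕ, entropy (convPow μ n) ≤ ENNReal.ofReal (C + n * b)) :
    ∑' y, geomMixture μ s y * surprisal (geomMixture μ s y)
      ≤ ENNReal.ofReal (C - Real.log (1 - s) + s / (1 - s) * (b - Real.log s)) := by
  have h1 : 0 < 1 - s := by linarith
  have l1 := Real.log_nonpos hs0.le hs1.le
  have l2 := Real.log_nonpos h1.le (by linarith)
  rw [tsum_geomMixture_mul]
  calc _ ≤ ∑' n : ℕ, geomWeight s n * (ENNReal.ofReal (C - Real.log (1 - s))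
          + n * ENNReal.ofReal (b - Real.log s)) := by
        refine ENNReal.tsum_le_tsum fun n => ?_
        calc _ ≤ ∑' y, (geomWeight s n * convPow μ n y * (ENNReal.ofReal (-Real.log (1 - s))
                + n * ENNReal.ofReal (-Real.log s) + surprisal (convPow μ n y))) := by
              rw [← ENNReal.tsum_mul_left]
              refine ENNReal.tsum_le_tsum fun y => ?_
              rw [← mul_assoc]
              refine (mul_surprisal_le (geomWeight_le_one hs0 hs1 n) (PMF.coe_le_one _ _)
                (geomMixture_le_one μ hs0 hs1 y) (ENNReal.le_tsum n)).trans ?_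
              gcongr
              exact surprisal_geomWeight_le hs0 hs1 n
          _ = geomWeight s n * (ENNReal.ofReal (-Real.log (1 - s))
                + n * ENNReal.ofReal (-Real.log s) + entropy (convPow μ n)) := by
              simp_rw [mul_assoc]
              rw [ENNReal.tsum_mul_left]
              simp_rw [mul_add]
              rw [ENNReal.tsum_add, ENNReal.tsum_add,
                ENNReal.tsum_mul_right, ENNReal.tsum_mul_right, PMF.tsum_coe,
                ← entropy_eq_tsum_mul_surprisal, one_mul, one_mul, mul_add, mul_add]
          _ ≤ _ := by
              refine mul_le_mul' le_rfl ?_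
              refine (add_le_add le_rfl (hH n)).trans (le_of_eq ?_)
              rw [← ENNReal.ofReal_natCast n, ← ENNReal.ofReal_mul n.cast_nonneg,
                ← ENNReal.ofReal_mul n.cast_nonneg, ← ENNReal.ofReal_add (by linarith)
                  (mul_nonneg n.cast_nonneg (by linarith)),
                ← ENNReal.ofReal_add (add_nonneg (by linarith)
                  (mul_nonneg n.cast_nonneg (by linarith))) (by positivity),
                ← ENNReal.ofReal_add (by linarith) (mul_nonneg n.cast_nonneg (by linarith))]
              congr 1
              ring
    _ = _ := by
        simp_rw [mul_add, ← mul_assoc]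
        rw [ENNReal.tsum_add, ENNReal.tsum_mul_right, ENNReal.tsum_mul_right,
          tsum_geomWeight hs0 hs1, tsum_geomWeight_mul_natCast hs0 hs1, one_mul,
          ← ENNReal.ofReal_mul (by positivity),
          ← ENNReal.ofReal_add (by linarith) (mul_nonneg (by positivity) (by linarith))]

end GeometricMixture

/-! ### Averages over random edges and the limit `s → 1`. -/

section LowerBound

variable {Γ : Type*} [Group Γ]

/-- Reversal of the edges `x → g x`. -/
def edgeRev : Γ × Γ ≃ Γ × Γ where
  toFun p := (p.1⁻¹, p.1 * p.2)
  invFun p := (p.1⁻¹, p.1 * p.2)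
  left_inv p := by simp
  right_inv p := by simp

/-- The law of a random edge `x → g x`: `g` has law `μ`, and `x` is an independent position of the
random walk at a geometric time. -/
noncomputable def edgeWeight (μ : PMF Γ) (s : ℝ) (p : Γ × Γ) : ℝ :=
  (μ p.1 * geomMixture μ s p.2).toReal

variable {μ : PMF Γ} {s : ℝ}

lemma edgeWeight_nonneg (p : Γ × Γ) : 0 ≤ edgeWeight μ s p := ENNReal.toReal_nonneg

lemma edgeRev_edgeRev (p : Γ × Γ) : edgeRev (edgeRev p) = p := edgeRev.left_inv p

lemma edgeWeight_edgeRev (hsymm : ∀ g : Γ, μ g⁻¹ = μ g) (p : Γ × Γ) :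
    edgeWeight μ s (edgeRev p) = (μ p.1).toReal * (geomMixture μ s (p.1 * p.2)).toReal := by
  simp only [edgeWeight, edgeRev, Equiv.coe_fn_mk, ENNReal.toReal_mul, hsymm]

lemma edgeWeight_eq_zero_iff (hsymm : ∀ g : Γ, μ g⁻¹ = μ g) (hs0 : 0 < s) (hs1 : s < 1)
    (p : Γ × Γ) : edgeWeight μ s p = 0 ↔ edgeWeight μ s (edgeRev p) = 0 := by
  have key : ∀ p, edgeWeight μ s p ≠ 0 → edgeWeight μ s (edgeRev p) ≠ 0 := by
    rintro ⟨g, x⟩ h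
    rw [edgeWeight_edgeRev hsymm]
    simp only [edgeWeight, ENNReal.toReal_mul, mul_ne_zero_iff, ENNReal.toReal_ne_zero] at h ⊢
    exact ⟨h.1, geomMixture_mul_ne_zero μ hs0 h.1.1 h.2.1, geomMixture_ne_top μ hs0 hs1 _⟩
  refine ⟨fun h => ?_, fun h => ?_⟩
  · by_contra h'
    have := key _ h'
    rw [edgeRev_edgeRev] at this
    exact this h
  · by_contra h'
    exact key _ h' h

lemma hasSum_edgeWeight_mul {G : Γ × Γ → ℝ≥0∞}
    (hG : ∑' p, μ p.1 * geomMixture μ s p.2 * G p ≠ ⊤) :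
    HasSum (fun p => edgeWeight μ s p * (G p).toReal)
      (∑' p, μ p.1 * geomMixture μ s p.2 * G p).toReal := by
  have h := ENNReal.hasSum_toReal hG
  rw [← ENNReal.tsum_toReal_eq (ENNReal.ne_top_of_tsum_ne_top hG)] at h
  simpa only [edgeWeight, ENNReal.toReal_mul (b := G _)] using h

lemma hasSum_edgeWeight_mul_source {F : Γ → ℝ≥0∞} (hF : ∑' y, geomMixture μ s y * F y ≠ ⊤) :
    HasSum (fun p : Γ × Γ => edgeWeight μ s p * (F p.2).toReal)
      (∑' y, geomMixture μ s y * F y).toReal := by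
  have h := tsum_prod_mul_geomMixture_mul μ s F
  rw [← h]
  exact hasSum_edgeWeight_mul (G := fun p => F p.2) (h ▸ hF)

/-- The endpoint of the edge has law `μ*q`, and `s μ*q = q - (1-s) δ_e`. The atom at `e` costs
nothing for the length, and for the surprisal discarding it gives an inequality in the needed
direction. -/
lemma exists_hasSum_edgeWeight_mul_target (hs0 : 0 < s) {F : Γ → ℝ≥0∞}
    (hF : ∑' y, geomMixture μ s y * F y ≠ ⊤) :
    ∃ a, HasSum (fun p : Γ × Γ => edgeWeight μ s p * (F (p.1 * p.2)).toReal) a ∧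
      s * a ≤ (∑' y, geomMixture μ s y * F y).toReal ∧
      (F 1 = 0 → s * a = (∑' y, geomMixture μ s y * F y).toReal) := by
  have h := tsum_geomMixture_mul_eq μ hs0 F
  have hs_ne : ENNReal.ofReal s ≠ 0 := by simpa using hs0
  have hne : ∑' p : Γ × Γ, μ p.1 * geomMixture μ s p.2 * F (p.1 * p.2) ≠ ⊤ := by
    intro h'
    rw [h', ENNReal.mul_top hs_ne, add_top] at h
    exact hF h
  refine ⟨_, hasSum_edgeWeight_mul (G := fun p => F (p.1 * p.2)) hne, ?_, fun h0 => ?_⟩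
  · rw [← ENNReal.toReal_ofReal hs0.le, ← ENNReal.toReal_mul, ENNReal.toReal_ofReal hs0.le]
    exact ENNReal.toReal_mono hF (h ▸ le_add_self)
  · rw [h, h0, mul_zero, zero_add, ENNReal.toReal_mul, ENNReal.toReal_ofReal hs0.le]

lemma hasSum_toReal_geomMixture (μ : PMF Γ) (hs0 : 0 < s) (hs1 : s < 1) :
    HasSum (fun x => (geomMixture μ s x).toReal) 1 := by
  have h := tsum_geomMixture μ hs0 hs1
  have := ENNReal.hasSum_toReal (h ▸ ENNReal.one_ne_top)
  rwa [← ENNReal.tsum_toReal_eq (geomMixture_ne_top μ hs0 hs1), h, ENNReal.toReal_one] at this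

lemma hasSum_edgeWeight (hs0 : 0 < s) (hs1 : s < 1) : HasSum (edgeWeight μ s) 1 := by
  have h := tsum_geomMixture μ hs0 hs1
  have := hasSum_edgeWeight_mul_source (μ := μ) (s := s) (F := fun _ => 1) (by simp [h])
  simpa [h] using this

lemma tsum_geomMixture_mul_length_ne_top [MetricSpace Γ]
    (hleft : ∀ g x y : Γ, dist (g * x) (g * y) = dist x y)
    (hmoment : Summable fun g : Γ => length g ^ 2 * (μ g).toReal) (hs0 : 0 < s) (hs1 : s < 1) :
    ∑' y, geomMixture μ s y * ENNReal.ofReal (length y) ≠ ⊤ := by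
  have h : ∑' y, geomMixture μ s y * ENNReal.ofReal (length y)
      ≤ ENNReal.ofReal (s / (1 - s)) * ∑' g, μ g * ENNReal.ofReal (length g) := by
    rw [tsum_geomMixture_mul, ← tsum_geomWeight_mul_natCast hs0 hs1, ← ENNReal.tsum_mul_right]
    refine ENNReal.tsum_le_tsum fun n => ?_
    rw [mul_assoc]
    exact mul_le_mul' le_rfl (tsum_convPow_mul_length_le hleft μ n)
  exact ne_top_of_le_ne_top (ENNReal.mul_ne_top ENNReal.ofReal_ne_top
    (tsum_mul_length_ne_top hmoment)) h

lemma exists_hasSum_edgeWeight_displacement [MetricSpace Γ]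
    (hleft : ∀ g x y : Γ, dist (g * x) (g * y) = dist x y)
    (hmoment : Summable fun g : Γ => length g ^ 2 * (μ g).toReal) (hs0 : 0 < s) (hs1 : s < 1) :
    ∃ d, HasSum (fun p : Γ × Γ => edgeWeight μ s p * (length (p.1 * p.2) - length p.2)) d ∧
      drift μ ≤ d := by
  have h1 : 0 < 1 - s := by linarith
  have hQtop := tsum_geomMixture_mul_length_ne_top hleft hmoment hs0 hs1
  -- By Fekete `n ℓ` is a lower bound for the mean length at every time `n`, so averaging over the
  -- geometric time loses nothing. The mean displacement is `(1-s)/s` times this average, hence at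
  -- least `ℓ`.
  have hQge : s / (1 - s) * drift μ
      ≤ (∑' y, geomMixture μ s y * ENNReal.ofReal (length y)).toReal := by
    rw [← ENNReal.ofReal_le_iff_le_toReal hQtop, tsum_geomMixture_mul,
      ENNReal.ofReal_mul (by positivity), ← tsum_geomWeight_mul_natCast hs0 hs1,
      ← ENNReal.tsum_mul_right]
    refine ENNReal.tsum_le_tsum fun n => ?_
    rw [mul_assoc]
    refine mul_le_mul' le_rfl ?_
    rw [← ENNReal.ofReal_natCast n, ← ENNReal.ofReal_mul n.cast_nonneg,
      ENNReal.ofReal_le_iff_le_toReal (tsum_convPow_mul_length_ne_top hleft hmoment n),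
      toReal_tsum_mul_length]
    exact (tendsto_drift_and_le hleft hmoment).2 n
  have hQ1 := hasSum_edgeWeight_mul_source hQtop
  obtain ⟨a, hQ2, -, ha⟩ := exists_hasSum_edgeWeight_mul_target hs0 hQtop
  replace ha := ha (by simp [length_one])
  simp only [ENNReal.toReal_ofReal (length_nonneg _)] at hQ1 hQ2
  refine ⟨_, by simpa only [mul_sub] using hQ2.sub hQ1, ?_⟩
  rw [div_mul_eq_mul_div, div_le_iff₀ h1] at hQge
  refine le_of_mul_le_mul_left ?_ hs0
  linarith

lemma exists_hasSum_edgeWeight_sq_displacement [MetricSpace Γ]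
    (hleft : ∀ g x y : Γ, dist (g * x) (g * y) = dist x y)
    (hmoment : Summable fun g : Γ => length g ^ 2 * (μ g).toReal) (hs0 : 0 < s) (hs1 : s < 1) :
    ∃ V, HasSum (fun p : Γ × Γ => edgeWeight μ s p * (length (p.1 * p.2) - length p.2) ^ 2) V ∧
      V ≤ M₂ μ ^ 2 := by
  have hq := hasSum_toReal_geomMixture μ hs0 hs1
  have hprod : HasSum (fun p : Γ × Γ =>
      length p.1 ^ 2 * (μ p.1).toReal * (geomMixture μ s p.2).toReal) (M₂ μ ^ 2) := by
    have := hmoment.hasSum.mul hq (hmoment.mul_of_nonneg hq.summable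
      (fun g => mul_nonneg (sq_nonneg _) ENNReal.toReal_nonneg) fun x => ENNReal.toReal_nonneg)
    rwa [mul_one, ← M₂_sq] at this
  have hle : ∀ p : Γ × Γ, edgeWeight μ s p * (length (p.1 * p.2) - length p.2) ^ 2
      ≤ length p.1 ^ 2 * (μ p.1).toReal * (geomMixture μ s p.2).toReal := by
    intro p
    have h : (length (p.1 * p.2) - length p.2) ^ 2 ≤ length p.1 ^ 2 :=
      sq_le_sq.2 ((abs_length_mul_sub_le hleft _ _).trans (le_abs_self _))
    have := mul_le_mul_of_nonneg_left h (edgeWeight_nonneg (μ := μ) (s := s) p)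
    refine this.trans (le_of_eq ?_)
    rw [edgeWeight, ENNReal.toReal_mul]
    ring
  have hV := (Summable.of_nonneg_of_le
    (fun p => mul_nonneg (edgeWeight_nonneg p) (sq_nonneg _)) hle hprod.summable).hasSum
  exact ⟨_, hV, hasSum_le hle hV hprod⟩

lemma exists_hasSum_sqrt_edgeWeight (hsymm : ∀ g : Γ, μ g⁻¹ = μ g) (hs0 : 0 < s) (hs1 : s < 1) :
    ∃ R, HasSum (fun p => √(edgeWeight μ s p * edgeWeight μ s (edgeRev p))) R ∧
      R ≤ spectralRadius μ := by
  have hle : ∀ S : Finset (Γ × Γ),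
      ∑ p ∈ S, √(edgeWeight μ s p * edgeWeight μ s (edgeRev p)) ≤ spectralRadius μ := by
    intro S
    refine le_trans (le_of_eq (Finset.sum_congr rfl fun p _ => ?_))
      (sum_mul_sqrt_le_spectralRadius hsymm (fun x => ENNReal.toReal_nonneg)
        (hasSum_toReal_geomMixture μ hs0 hs1) S)
    rw [edgeWeight_edgeRev hsymm, edgeWeight, ENNReal.toReal_mul,
      show ∀ a b c : ℝ, a * b * (a * c) = a ^ 2 * (b * c) by intros; ring,
      Real.sqrt_mul (sq_nonneg _), Real.sqrt_sq ENNReal.toReal_nonneg]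
  exact ⟨_, (summable_of_sum_le (fun p => Real.sqrt_nonneg _) hle).hasSum,
    Real.tsum_le_of_sum_le (fun p => Real.sqrt_nonneg _) hle⟩

lemma exists_hasSum_edgeWeight_log (hsymm : ∀ g : Γ, μ g⁻¹ = μ g) (hs0 : 0 < s) (hs1 : s < 1)
    {H : ℝ} (hH0 : 0 ≤ H)
    (hH : ∑' y, geomMixture μ s y * surprisal (geomMixture μ s y) ≤ ENNReal.ofReal H) :
    ∃ h, HasSum (fun p => edgeWeight μ s p *
      (Real.log (edgeWeight μ s p) - Real.log (edgeWeight μ s (edgeRev p)))) h ∧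
      h ≤ H * ((1 - s) / s) := by
  have h1 : 0 < 1 - s := by linarith
  have hHle := ENNReal.toReal_mono ENNReal.ofReal_ne_top hH
  rw [ENNReal.toReal_ofReal hH0] at hHle
  have htop := ne_top_of_le_ne_top ENNReal.ofReal_ne_top hH
  have hH1 := hasSum_edgeWeight_mul_source htop
  obtain ⟨a, hH2, ha, -⟩ := exists_hasSum_edgeWeight_mul_target hs0 htop
  have hsurp : ∀ x, (surprisal (geomMixture μ s x)).toReal
      = -Real.log (geomMixture μ s x).toReal := by
    intro x
    have := toReal_mul_surprisal (a := 1) (geomMixture_le_one μ hs0 hs1 x)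
    simpa using this
  simp only [hsurp] at hH1 hH2
  refine ⟨_, (hH2.sub hH1).congr_fun fun p => ?_, ?_⟩
  · rcases eq_or_ne (edgeWeight μ s p) 0 with h0 | h0
    · simp [h0]
    · have h0' := mt (edgeWeight_eq_zero_iff hsymm hs0 hs1 p).2 h0
      rw [edgeWeight_edgeRev hsymm] at h0' ⊢
      rw [edgeWeight, ENNReal.toReal_mul] at h0 ⊢
      rw [Real.log_mul (left_ne_zero_of_mul h0) (right_ne_zero_of_mul h0),
        Real.log_mul (left_ne_zero_of_mul h0') (right_ne_zero_of_mul h0')]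
      ring
  · refine le_trans ?_ (mul_le_mul_of_nonneg_right hHle (by positivity))
    rw [← mul_div_assoc, le_div_iff₀ hs0]
    linarith

lemma rate_le_of_entropy_le [MetricSpace Γ]
    (hleft : ∀ g x y : Γ, dist (g * x) (g * y) = dist x y) (hsymm : ∀ g : Γ, μ g⁻¹ = μ g)
    (hmoment : Summable fun g : Γ => length g ^ 2 * (μ g).toReal) (hs0 : 0 < s)
    (hs1 : s < 1) {C b : ℝ} (hC : 0 ≤ C) (hb : 0 ≤ b)
    (hH : ∀ n : ℕ, entropy (convPow μ n) ≤ ENNReal.ofReal (C + n * b)) {x₀ : ℝ} (hx₀ : 0 ≤ x₀)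
    (hx₁ : x₀ < 1) (hxd : x₀ ≤ drift μ / M₂ μ) :
    A x₀ - 2 * Real.log (spectralRadius μ)
      ≤ (C - Real.log (1 - s) + s / (1 - s) * (b - Real.log s)) * ((1 - s) / s) := by
  have h1 : 0 < 1 - s := by linarith
  have l1 := Real.log_nonpos hs0.le hs1.le
  have l2 := Real.log_nonpos h1.le (by linarith)
  obtain ⟨d, hd, hdd⟩ := exists_hasSum_edgeWeight_displacement hleft hmoment hs0 hs1
  obtain ⟨V, hV, hVM⟩ := exists_hasSum_edgeWeight_sq_displacement hleft hmoment hs0 hs1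
  obtain ⟨R, hR, hRρ⟩ := exists_hasSum_sqrt_edgeWeight hsymm hs0 hs1
  obtain ⟨h, hh, hle⟩ := exists_hasSum_edgeWeight_log hsymm hs0 hs1
    (add_nonneg (by linarith) (mul_nonneg (by positivity) (by linarith)))
    (tsum_geomMixture_mul_surprisal_le μ hs0 hs1 hC hb hH)
  exact (rate_le_relative_entropy edgeRev edgeRev_edgeRev edgeWeight_nonneg
    (edgeWeight_eq_zero_iff hsymm hs0 hs1)
    (b := fun p : Γ × Γ => length (p.1 * p.2) - length p.2) (by simp [edgeRev])
    (hasSum_edgeWeight hs0 hs1) hd hV hR hh hVM (spectralRadius_pos hsymm) hRρ hx₀ hx₁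
    (hxd.trans (div_le_div_of_nonneg_right hdd (Real.sqrt_nonneg _)))).trans hle

lemma exists_entropy_convPow_le {μ : PMF Γ} {b : ℝ} (hb : 0 < b)
    (h : asymptoticEntropy μ < ENNReal.ofReal b) :
    ∃ C, 0 ≤ C ∧ ∀ n : ℕ, entropy (convPow μ n) ≤ ENNReal.ofReal (C + n * b) := by
  have hev : ∀ᶠ n : ℕ in atTop, entropy (convPow μ n) ≤ ENNReal.ofReal (n * b) := by
    filter_upwards [(tendsto_asymptoticEntropy μ).eventually_lt_const h, eventually_gt_atTop 0]
      with n hn hn0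
    have := (ENNReal.div_le_iff (by exact_mod_cast hn0.ne') (ENNReal.natCast_ne_top n)).1 hn.le
    rwa [ENNReal.ofReal_mul n.cast_nonneg, ENNReal.ofReal_natCast, mul_comm]
  obtain ⟨N, hN⟩ := eventually_atTop.1 hev
  have hμ : entropy μ ≠ ⊤ := ne_top_of_le_ne_top ENNReal.ofReal_ne_top
    ((entropy_le_entropy_convPow_succ μ N).trans (hN (N + 1) N.le_succ))
  -- The constant absorbs the finitely many times before the bound `n b` takes effect.
  refine ⟨∑ n ∈ Finset.range N, (entropy (convPow μ n)).toReal,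
    Finset.sum_nonneg fun n _ => ENNReal.toReal_nonneg, fun n => ?_⟩
  have hS : 0 ≤ ∑ n ∈ Finset.range N, (entropy (convPow μ n)).toReal :=
    Finset.sum_nonneg fun n _ => ENNReal.toReal_nonneg
  rcases le_or_gt N n with hn | hn
  · exact (hN n hn).trans (ENNReal.ofReal_le_ofReal (by linarith))
  · rw [← ENNReal.ofReal_toReal (entropy_convPow_ne_top hμ n)]
    refine ENNReal.ofReal_le_ofReal ?_
    have := Finset.single_le_sum (f := fun n => (entropy (convPow μ n)).toReal)
      (fun n _ => ENNReal.toReal_nonneg) (Finset.mem_range.2 hn)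
    have h2 : 0 ≤ n * b := by positivity
    linarith

lemma tendsto_entropy_bound (C b : ℝ) :
    Tendsto (fun s : ℝ => (C - Real.log (1 - s) + s / (1 - s) * (b - Real.log s)) * ((1 - s) / s))
      (𝓝[<] 1) (𝓝 b) := by
  -- Multiplied out, the only delicate term is `(1-s) log(1-s)`, which tends to `0` by continuity of
  -- `x log x`.
  have hcont : ContinuousAt (fun s : ℝ => (C * (1 - s) - (1 - s) * Real.log (1 - s)) / s
      + (b - Real.log s)) 1 := by
    have h := Real.continuous_mul_log.comp (continuous_const.sub continuous_id : Continuous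
      fun s : ℝ => 1 - s)
    refine ContinuousAt.add (ContinuousAt.div (ContinuousAt.sub (by fun_prop) h.continuousAt)
      continuousAt_id one_ne_zero) (continuousAt_const.sub (Real.continuousAt_log one_ne_zero))
  have ht := hcont.tendsto.mono_left (nhdsWithin_le_nhds (s := Set.Iio 1))
  simp only [sub_self, mul_zero, Real.log_zero, zero_div, Real.log_one, sub_zero, zero_add] at ht
  refine ht.congr' ?_
  filter_upwards [Ioo_mem_nhdsLT (zero_lt_one (α := ℝ))] with s hs
  have h1 : 1 - s ≠ 0 := by linarith [hs.2]
  have h2 := hs.1.ne'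
  field_simp

lemma rate_le_of_asymptoticEntropy_lt [MetricSpace Γ]
    (hleft : ∀ g x y : Γ, dist (g * x) (g * y) = dist x y) {μ : PMF Γ}
    (hsymm : ∀ g : Γ, μ g⁻¹ = μ g)
    (hmoment : Summable fun g : Γ => length g ^ 2 * (μ g).toReal) {b : ℝ} (hb : 0 < b)
    (h : asymptoticEntropy μ < ENNReal.ofReal b) (hdM : drift μ / M₂ μ ≤ 1) :
    A (drift μ / M₂ μ) - 2 * Real.log (spectralRadius μ) ≤ b := by
  obtain ⟨C, hC, hH⟩ := exists_entropy_convPow_le hb h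
  -- The tangent to `A` in `x²` has finite slope only below `1`; the extreme case `ℓ = M₂` follows
  -- by continuity of `A`.
  have key : ∀ x₀, 0 ≤ x₀ → x₀ < 1 → x₀ ≤ drift μ / M₂ μ →
      A x₀ - 2 * Real.log (spectralRadius μ) ≤ b := by
    intro x₀ h0 h1 hxd
    refine ge_of_tendsto (tendsto_entropy_bound C b) ?_
    filter_upwards [Ioo_mem_nhdsLT (zero_lt_one (α := ℝ))] with s hs
    exact rate_le_of_entropy_le hleft hsymm hmoment hs.1 hs.2 hC hb.le hH h0 h1 hxd
  have h0 : 0 ≤ drift μ / M₂ μ := div_nonneg (drift_nonneg hleft hmoment) (Real.sqrt_nonneg _)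
  rcases hdM.lt_or_eq with hlt | heq
  · exact key _ h0 hlt le_rfl
  · rw [heq] at key ⊢
    have ht : Tendsto (fun x => A x - 2 * Real.log (spectralRadius μ)) (𝓝[<] 1)
        (𝓝 (A 1 - 2 * Real.log (spectralRadius μ))) :=
      ((continuous_A.sub continuous_const).tendsto 1).mono_left nhdsWithin_le_nhds
    refine le_of_tendsto ht ?_
    filter_upwards [Ioo_mem_nhdsLT (zero_lt_one (α := ℝ))] with x hx
    exact key x hx.1.le hx.2 hx.2.le

end LowerBound

end RandomWalk

/-! ### The entropy inequality and its comparison with the earlier bounds. -/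

theorem mainTheorem7 {Γ : Type*} [Group Γ] [Countable Γ] [MetricSpace Γ]
    (hleft : ∀ g x y : Γ, dist (g * x) (g * y) = dist x y)
    (hproper : ∀ r : ℝ, (Metric.closedBall (1 : Γ) r).Finite)
    (μ : PMF Γ)
    (hsymm : ∀ g : Γ, μ g⁻¹ = μ g)
    (hmoment : Summable fun g : Γ => RandomWalk.length g ^ 2 * (μ g).toReal) :
    (∀ n : ℕ, Summable fun g : Γ =>
      RandomWalk.length g * (RandomWalk.convPow μ n g).toReal) ∧
    Tendsto (fun n : ℕ => RandomWalk.meanLength μ n / (n : ℝ)) atTop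
      (𝓝 (RandomWalk.drift μ)) ∧
    Tendsto (fun n : ℕ => RandomWalk.entropy (RandomWalk.convPow μ n) / (n : ℝ≥0∞)) atTop
      (𝓝 (RandomWalk.asymptoticEntropy μ)) ∧
    (0 < RandomWalk.spectralRadius μ ∧ RandomWalk.spectralRadius μ ≤ 1) ∧
    ((RandomWalk.A (RandomWalk.drift μ / RandomWalk.M₂ μ)
        + 2 * |Real.log (RandomWalk.spectralRadius μ)| : ℝ) : EReal)
      ≤ (RandomWalk.asymptoticEntropy μ : EReal) ∧
    -2 * Real.log (RandomWalk.spectralRadius μ)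
      ≤ RandomWalk.A (RandomWalk.drift μ / RandomWalk.M₂ μ)
        + 2 * |Real.log (RandomWalk.spectralRadius μ)| ∧
    ∀ k : ℝ, (∀ g : Γ, μ g ≠ 0 → RandomWalk.length g ≤ k) →
      2 * (RandomWalk.A (RandomWalk.drift μ / k) / 2
          - Real.log (RandomWalk.spectralRadius μ))
        ≤ RandomWalk.A (RandomWalk.drift μ / RandomWalk.M₂ μ)
          + 2 * |Real.log (RandomWalk.spectralRadius μ)| := by
  open RandomWalk in
  have hρ0 := spectralRadius_pos hsymm
  have hρ1 := spectralRadius_le_one μ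
  have habs : |Real.log (spectralRadius μ)| = -Real.log (spectralRadius μ) :=
    abs_of_nonpos (Real.log_nonpos hρ0.le hρ1)
  have hℓ0 := drift_nonneg hleft hmoment
  have hM0 : 0 ≤ M₂ μ := Real.sqrt_nonneg _
  have hx : drift μ / M₂ μ ∈ Set.Icc (0 : ℝ) 1 :=
    ⟨div_nonneg hℓ0 hM0, div_le_one_of_le₀ (drift_le_M₂ hleft hmoment) hM0⟩
  refine ⟨summable_length_mul_convPow hleft hmoment, (tendsto_drift_and_le hleft hmoment).1,
    tendsto_asymptoticEntropy μ, ⟨hρ0, hρ1⟩, ?_, ?_, ?_⟩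
  · rw [habs]
    rcases eq_or_ne (asymptoticEntropy μ) ⊤ with htop | hfin
    · simp [htop]
    · rw [← ENNReal.ofReal_toReal hfin, EReal.coe_ennreal_ofReal,
        max_eq_left ENNReal.toReal_nonneg, EReal.coe_le_coe_iff]
      refine le_of_forall_gt_imp_ge_of_dense fun b hb => ?_
      have := rate_le_of_asymptoticEntropy_lt hleft hsymm hmoment
        (ENNReal.toReal_nonneg.trans_lt hb) ((ENNReal.lt_ofReal_iff_toReal_lt hfin).2 hb) hx.2
      linarith
  · rw [habs]
    linarith [A_nonneg hx]
  · intro k hk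
    obtain ⟨g₀, hg₀⟩ := μ.support_nonempty
    have hk0 : 0 ≤ k := (length_nonneg g₀).trans (hk g₀ hg₀)
    have hMk : M₂ μ ≤ k := M₂_le hmoment hk0 hk
    -- If `M₂ = 0` then `ℓ = 0` and both quotients are `0`, so the convention for division by zero
    -- agrees with the stated reading.
    have hle : drift μ / k ≤ drift μ / M₂ μ := by
      rcases hM0.eq_or_lt with h0 | hpos
      · have hz : drift μ = 0 := le_antisymm (h0 ▸ drift_le_M₂ hleft hmoment) hℓ0
        simp [hz]
      · exact div_le_div_of_nonneg_left hℓ0 hpos hMk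
    have := monotoneOn_A ⟨div_nonneg hℓ0 hk0, hle.trans hx.2⟩ hx hle
    rw [habs]
    linarith
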